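/- Let $N$ be a lattice of rank $d$ and $N_{\mathbb R}=N\otimes_{\mathbb Z}\mathbb R$. Let $\Sigma$ be a (finite) simplicial rational fan of dimension $d$ in $N_{\mathbb R}$ whose support $|\Sigma|$ is convex, let $v_1,\dots,v_r\in N$ be the primitive generators of its rays, and let $b_i=a_iv_i$ for given positive integers $a_1,\dots,a_r$. Let $\psi:|\Sigma|\to\mathbb R$ be the function that is linear on each cone of $\Sigma$ with $\psi(b_i)=1$ for all $i$, and put $Q=\{v\in|\Sigma| : \psi(v)\le 1\}$. Let $\partial Q_0$ be the union of the facets of $\partial Q$ not containing the origin, i.e. of the simplices $\mathrm{conv}\{b_i : v_i\in\sigma\}$ over the $d$-dimensional cones $\sigma$ of $\Sigma$. For $v\in|\Sigma|\cap N$ let $w_0(v)=\psi(v)-\lceil\psi(v)\rceil$; for $k\in\mathbb Q$ and an integer $m\ge 0$ let $f^0_k(m)$ be the number of $v\in mQ\cap N$ with $w_0(v)=k$; and define $$\delta^0_k(t)=(1-t)^{d+1}\sum_{m\ge0}f^0_k(m)\,t^m,\qquad \delta^0(t)=\sum_{k\in\mathbb Q}\delta^0_k(t)\,t^k .$$ Then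 $\delta^0(t)$ is a polynomial in rational powers of $t$: it is a finite sum of terms $p_q t^q$ with $q\in\mathbb Q$, $0\le q\le d$, and with non-negative integer coefficients $p_q$. If $\Sigma$ is complete (that is, $|\Sigma|=N_{\mathbb R}$), then $\delta^0(t)=t^d\delta^0(t^{-1})$. Moreover: 1. $\delta^0(1)=d!\,\mathrm{vol}_d(Q)$, where $\mathrm{vol}_d$ is normalised so that a fundamental parallelotope of $N$ has volume $1$. 2. The constant coefficient of $\delta^0(t)$ is $1$. 3. For every rational $l$ with $0<l<1$, the coefficient of $t^l$ in $\delta^0(t)$ is $|\{v\in Q\cap N : \psi(v)=l\}|$. 4. The coefficient of $t$ in $\delta^0(t)$ is $|\partial Q_0\cap N|-d$. -/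

import Mathlib

open scoped Pointwise

noncomputable section

/-- The cone of all non-negative real combinations of the vectors `u i`, `i ∈ σ`. -/
def coneOver {V : Type*} [AddCommGroup V] [Module ℝ V] {r : ℕ}
    (u : Fin r → V) (σ : Finset (Fin r)) : Set V :=
  {x | ∃ c : Fin r → ℝ, (∀ i, 0 ≤ c i) ∧ x = ∑ i ∈ σ, c i • u i}

/-- A stacky fan `(N, Σ, {b_i})` with `Σ` a finite simplicial rational fan in `N_ℝ = V`, where the
lattice `N` is `L ⊆ V`. The rays `ρ_i` are indexed by `Fin r`; a cone of `Σ` is recorded by the set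
`σ` of (indices of) its rays, so that the cone itself is `coneOver v σ`. -/
structure StackyFan {V : Type*} [AddCommGroup V] [Module ℝ V] (L : Submodule ℤ V) (r : ℕ) where
  /-- the primitive integer generators `v_i` of the rays -/
  v : Fin r → V
  v_mem : ∀ i, v i ∈ L
  v_primitive : ∀ i, ∀ w ∈ L, ∀ n : ℕ, v i = n • w → n = 1
  /-- the positive integers `a_i` with `b_i = a_i v_i` -/
  a : Fin r → ℕ
  a_pos : ∀ i, 0 < a i
  /-- the cones of the fan -/
  cones : Set (Finset (Fin r))
  zero_mem : ∅ ∈ cones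
  ray_mem : ∀ i, {i} ∈ cones
  /-- the faces of a simplicial cone are the cones over subsets of its rays -/
  face_mem : ∀ σ ∈ cones, ∀ τ ⊆ σ, τ ∈ cones
  simplicial : ∀ σ ∈ cones, LinearIndepOn ℝ v (σ : Set (Fin r))
  /-- two cones intersect in a common face -/
  inter_eq : ∀ σ ∈ cones, ∀ τ ∈ cones,
    coneOver v σ ∩ coneOver v τ = coneOver v (σ ∩ τ)

namespace StackyFan

section Algebra

variable {V : Type*} [AddCommGroup V] [Module ℝ V] {L : Submodule ℤ V} {r : ℕ}

/-- The lattice points `b_i = a_i v_i`. -/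
def b (F : StackyFan L r) (i : Fin r) : V := F.a i • F.v i

/-- The support `|Σ|`. -/
def support (F : StackyFan L r) : Set V := {x | ∃ σ ∈ F.cones, x ∈ coneOver F.v σ}

/-- `Σ` is complete if its support is the whole space. -/
def IsComplete (F : StackyFan L r) : Prop := F.support = Set.univ

/-- `y` is the sum of the coefficients of `x` in the generators `b_i` of a cone containing `x`. -/
def IsHeight (F : StackyFan L r) (x : V) (y : ℝ) : Prop :=
  ∃ σ ∈ F.cones, ∃ c : Fin r → ℝ, (∀ i, 0 ≤ c i) ∧
    x = ∑ i ∈ σ, c i • F.b i ∧ y = ∑ i ∈ σ, c i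

open Classical in
/-- The function `ψ : |Σ| → ℝ` that is linear on each cone with `ψ (b_i) = 1`;
see `psi_sum` and `psi_b`. (It takes the irrelevant value `0` outside `|Σ|`.) -/
def psi (F : StackyFan L r) (x : V) : ℝ :=
  if h : ∃ y, F.IsHeight x y then h.choose else 0

/-- `Q = {v ∈ |Σ| | ψ(v) ≤ 1}`. -/
def Q (F : StackyFan L r) : Set V := {x | x ∈ F.support ∧ F.psi x ≤ 1}

/-- `∂Q₀`, the union of the facets of `∂Q` not containing the origin. For a cone `σ` of full
dimension, `Q ∩ σ` is the simplex with vertices `0` and `b_i`, `i ∈ σ`, and its facet not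
containing the origin is the convex hull of the `b_i`, `i ∈ σ`. -/
def outerBoundary (F : StackyFan L r) : Set V :=
  {x | ∃ σ ∈ F.cones, σ.card = Module.finrank ℝ V ∧
    x ∈ convexHull ℝ (F.b '' (σ : Set (Fin r)))}

/-- The weight `w₀(v) = ψ(v) - ⌈ψ(v)⌉`. -/
def weight (F : StackyFan L r) (x : V) : ℝ := F.psi x - ⌈F.psi x⌉

/-- `f⁰_k(m)`, the number of lattice points of weight `k` in `mQ`. -/
def weightCount (F : StackyFan L r) (k : ℚ) (m : ℕ) : ℕ :=
  {x : V | x ∈ L ∧ x ∈ (m : ℝ) • F.Q ∧ F.weight x = (k : ℝ)}.ncard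

/-- `δ⁰_k(t) = (1 - t)^(d + 1) ∑_{m ≥ 0} f⁰_k(m) t^m`. -/
def deltaPart (F : StackyFan L r) (k : ℚ) : PowerSeries ℤ :=
  (1 - PowerSeries.X) ^ (Module.finrank ℝ V + 1) *
    PowerSeries.mk (fun m => (F.weightCount k m : ℤ))

/-- The weighted `δ`-vector `δ⁰(t) = ∑_{k ∈ ℚ} δ⁰_k(t) t^k`, a formal series with rational
exponents and integer coefficients (only finitely many summands are non-zero). -/
def weightedDelta (F : StackyFan L r) : HahnSeries ℚ ℤ :=
  ∑ᶠ k : ℚ, HahnSeries.ofPowerSeries ℚ ℤ (F.deltaPart k) * HahnSeries.single k 1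

theorem b_eq (F : StackyFan L r) (i : Fin r) : F.b i = (F.a i : ℝ) • F.v i := by
  rw [b, Nat.cast_smul_eq_nsmul]

/-- Equal non-negative combinations of the `v_i` over two cones have equal coefficients. -/
theorem coeff_unique (F : StackyFan L r) {σ τ : Finset (Fin r)} (hσ : σ ∈ F.cones)
    (hτ : τ ∈ F.cones) {c e : Fin r → ℝ} (hc : ∀ i, 0 ≤ c i) (he : ∀ i, 0 ≤ e i)
    (h : ∑ i ∈ σ, c i • F.v i = ∑ i ∈ τ, e i • F.v i) (g : Fin r → ℝ) :
    ∑ i ∈ σ, g i * c i = ∑ i ∈ τ, g i * e i := by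
  have key : ∀ ρ ∈ F.cones, ∀ p q : Fin r → ℝ, ∀ κ ⊆ ρ,
      ∑ i ∈ ρ, p i • F.v i = ∑ i ∈ κ, q i • F.v i →
      ∑ i ∈ ρ, g i * p i = ∑ i ∈ κ, g i * q i := by
    intro ρ hρ p q κ hκ hpq
    have h1 : ∑ i ∈ κ, q i • F.v i = ∑ i ∈ ρ, (if i ∈ κ then q i else 0) • F.v i := by
      simp only [ite_smul, zero_smul, Finset.sum_ite_mem, Finset.inter_eq_right.2 hκ]
    have h2 : ∑ i ∈ κ, g i * q i = ∑ i ∈ ρ, g i * (if i ∈ κ then q i else 0) := by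
      simp only [mul_ite, mul_zero, Finset.sum_ite_mem, Finset.inter_eq_right.2 hκ]
    have h3 := linearIndepOn_finset_iff.1 (F.simplicial ρ hρ)
      (fun i => p i - if i ∈ κ then q i else 0)
      (by simp only [sub_smul, Finset.sum_sub_distrib]; rw [hpq, h1, sub_self])
    rw [h2]
    exact Finset.sum_congr rfl fun i hi => by rw [sub_eq_zero.1 (h3 i hi)]
  have hmem : ∑ i ∈ σ, c i • F.v i ∈ coneOver F.v (σ ∩ τ) := by
    rw [← F.inter_eq σ hσ τ hτ]
    exact ⟨⟨c, hc, rfl⟩, ⟨e, he, h⟩⟩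
  obtain ⟨q, -, hq⟩ := hmem
  rw [key σ hσ c q _ Finset.inter_subset_left hq,
    key τ hτ e q _ Finset.inter_subset_right (h ▸ hq)]

/-- `ψ` is well defined and linear on each cone, with `ψ(b_i) = 1`. -/
theorem psi_sum (F : StackyFan L r) {σ : Finset (Fin r)} (hσ : σ ∈ F.cones)
    {c : Fin r → ℝ} (hc : ∀ i, 0 ≤ c i) :
    F.psi (∑ i ∈ σ, c i • F.b i) = ∑ i ∈ σ, c i := by
  have hex : ∃ y, F.IsHeight (∑ i ∈ σ, c i • F.b i) y := ⟨_, σ, hσ, c, hc, rfl, rfl⟩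
  rw [psi, dif_pos hex]
  obtain ⟨τ, hτ, e, he, hx, hy⟩ := hex.choose_spec
  rw [hy]
  simp only [b_eq, smul_smul] at hx
  have ha : ∀ i, (0 : ℝ) < F.a i := fun i => by exact_mod_cast F.a_pos i
  have h := F.coeff_unique hσ hτ (fun i => mul_nonneg (hc i) (ha i).le)
    (fun i => mul_nonneg (he i) (ha i).le) hx (fun i => (F.a i : ℝ)⁻¹)
  have hs : ∀ (i : Fin r) (z : ℝ), (F.a i : ℝ)⁻¹ * (z * F.a i) = z := fun i z => by
    field_simp [(ha i).ne']
  simp only [hs] at h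
  exact h.symm

theorem psi_b (F : StackyFan L r) (i : Fin r) : F.psi (F.b i) = 1 := by
  simpa using F.psi_sum (F.ray_mem i) (c := fun _ => 1) (fun _ => zero_le_one)

end Algebra

end StackyFan

/-- The volume on `V = N_ℝ`, normalised so that a fundamental parallelotope of the lattice `L = N`
has volume `1`. -/
def latticeVolume {V : Type*} [NormedAddCommGroup V] [NormedSpace ℝ V] [FiniteDimensional ℝ V]
    [MeasurableSpace V] [BorelSpace V] (L : Submodule ℤ V) (S : Set V) : ℝ :=
  (MeasureTheory.Measure.addHaar : MeasureTheory.Measure V).real S /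
    ZLattice.covolume L MeasureTheory.Measure.addHaar

/-- The value at `t` of the polynomial with rational powers `∑ p_q t^q`. -/
def ratPolyEval (p : ℚ →₀ ℕ) (t : ℝ) : ℝ := p.sum fun q n => (n : ℝ) * t ^ (q : ℝ)

end

/-! The proof is a half-open decomposition. Fix a point `x` of the support outside the span of every
cone of dimension below `d`, and delete from each `d`-dimensional cone σ the facets that separate it
from `x`. A point `y` of the support then lies in exactly one half-open cone, namely the one whose
interior contains `n • y + x` for all large `n`; convexity keeps these points in the support
(`exists_mem_halfOpenCone`, `IsGeneric.halfOpenCone_unique`).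

Each half-open cone is tiled by the translates of its half-open parallelotope under natural
combinations of the `b_i`. So a lattice point of the support is uniquely a box point `g` plus `∑ n_i
b_i`, and its height is `ψ(g) + ∑ n_i` (`bijOn_translate`, `psi_translate`). Summing geometric
series, each box point contributes `t^⌈ψ(g)⌉ / (1-t)^(d+1)` to the series of weight `w₀(g)`, whence
`δ⁰(t) = ∑_g t^ψ(g)` (`weightedDelta_eq`). This gives non-negativity and the bounds on exponents;
the low coefficients come from counting lattice points of height at most 1.

For the symmetry, `g ↦ ∑_{i ∈ σ} b_i - g` exchanges the boxes for `x` and `-x` and sends `ψ` to `d -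
ψ` (`boxVector_neg`). In a complete fan `-x` is also admissible, and `δ⁰` does not depend on the
choice. The value at 1 is the number of box points, found by comparing two asymptotics of the number
of lattice points in `mQ` (`card_boxFinset_eq`). -/

noncomputable section

/-! ### Counting natural vectors of given or bounded sum. -/

namespace PowerSeries

open Finset in
theorem one_sub_X_pow_mul_mk_card_piAntidiag {ι : Type*} [DecidableEq ι] (s : Finset ι) :
    (1 - X : PowerSeries ℤ) ^ s.card * mk (fun n => ((piAntidiag s n).card : ℤ)) = 1 := by
  induction s using Finset.cons_induction with
  | empty =>
    ext n
    rcases eq_or_ne n 0 with rfl | hn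
    · simp
    · simp [piAntidiag_empty_of_ne_zero hn, coeff_one, hn]
  | cons i s hi ih =>
    have : mk (fun n => ((piAntidiag (cons i s hi) n).card : ℤ)) =
        mk 1 * mk (fun n => ((piAntidiag s n).card : ℤ)) := by
      ext n
      rw [coeff_mk, piAntidiag_cons hi, card_disjiUnion, coeff_mul]
      simp
    rw [this, card_cons, pow_succ]
    calc _ = (mk 1 * (1 - X)) * ((1 - X : PowerSeries ℤ) ^ s.card *
          mk (fun n => ((piAntidiag s n).card : ℤ))) := by ring
      _ = 1 := by rw [ih, mk_one_mul_one_sub_eq_one, one_mul]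

end PowerSeries

theorem Finset.pairwiseDisjoint_piAntidiag {ι : Type*} [DecidableEq ι] (s : Finset ι)
    (t : Set ℕ) : t.PairwiseDisjoint fun n : ℕ => Finset.piAntidiag s n := by
  intro a _ b _ hab
  rw [Function.onFun, Finset.disjoint_left]
  intro f hf hf'
  rw [mem_piAntidiag] at hf hf'
  exact hab (hf.1.symm.trans hf'.1)

/-- The functions `ι → ℕ` supported in `s` whose values have sum at most `m`. -/
def Finset.piSumLe {ι : Type*} [DecidableEq ι] (s : Finset ι) (m : ℕ) : Finset (ι → ℕ) :=
  (Finset.range (m + 1)).disjiUnion (fun n => Finset.piAntidiag s n) 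
    (s.pairwiseDisjoint_piAntidiag _)

theorem Finset.mem_piSumLe {ι : Type*} [DecidableEq ι] {s : Finset ι} {m : ℕ} {f : ι → ℕ} :
    f ∈ s.piSumLe m ↔ (∀ i ∉ s, f i = 0) ∧ ∑ i ∈ s, f i ≤ m := by
  simp only [piSumLe, mem_disjiUnion, mem_range, mem_piAntidiag]
  constructor
  · rintro ⟨n, hn, h, h'⟩
    exact ⟨fun i hi => by_contra fun h => hi (h' i h), h.trans_le (Nat.le_of_lt_succ hn)⟩
  · rintro ⟨h, h'⟩
    exact ⟨∑ i ∈ s, f i, Nat.lt_succ_of_le h', rfl, fun i hi => by_contra fun h'' => hi (h i h'')⟩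

/-- Passing to partial sums multiplies the generating series by `1/(1-X)`. The counts and the
binomials are thus both coefficients of the inverse of `(1-X)^(card+1)`, which is unique. -/
theorem Finset.card_piSumLe {ι : Type*} [DecidableEq ι] (s : Finset ι) (m : ℕ) :
    (s.piSumLe m).card = (s.card + m).choose s.card := by
  have h1 : PowerSeries.mk (fun m => ((s.piSumLe m).card : ℤ)) =
      PowerSeries.mk 1 * PowerSeries.mk (fun n => ((piAntidiag s n).card : ℤ)) := by
    ext m
    rw [PowerSeries.coeff_mul, Finset.Nat.sum_antidiagonal_eq_sum_range_succ_mk, PowerSeries.coeff_mk,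
      piSumLe, card_disjiUnion, Nat.cast_sum, ← Finset.sum_range_reflect]
    simp
  have h2 : (1 - PowerSeries.X : PowerSeries ℤ) ^ (s.card + 1) *
      PowerSeries.mk (fun m => ((s.piSumLe m).card : ℤ)) = 1 := by
    rw [h1, pow_succ]
    calc _ = (PowerSeries.mk 1 * (1 - PowerSeries.X)) * ((1 - PowerSeries.X : PowerSeries ℤ) ^ s.card *
          PowerSeries.mk (fun n => ((piAntidiag s n).card : ℤ))) := by ring
      _ = 1 := by
        rw [PowerSeries.one_sub_X_pow_mul_mk_card_piAntidiag,
          PowerSeries.mk_one_mul_one_sub_eq_one, one_mul]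
  have h3 := PowerSeries.mk_add_choose_mul_one_sub_pow_eq_one ℤ s.card
  have h4 := left_inv_eq_right_inv h3 h2
  have h5 := congrArg (PowerSeries.coeff m) h4
  simp only [PowerSeries.coeff_mk] at h5
  exact_mod_cast h5.symm

theorem Finset.card_piAntidiag_one {ι : Type*} [DecidableEq ι] (s : Finset ι) :
    (piAntidiag s (1 : ℕ)).card = s.card := by
  have h0 := s.card_piSumLe 0
  have h1 := s.card_piSumLe 1
  rw [piSumLe, card_disjiUnion] at h0 h1
  simp [Finset.sum_range_succ] at h1
  omega

/-! ### Coordinates in the `b_i` and homogeneity of `ψ`. -/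

namespace StackyFan

section Algebra

variable {V : Type*} [AddCommGroup V] [Module ℝ V] {L : Submodule ℤ V} {r : ℕ}

/-- The linear combination `∑ c_i b_i`. -/
def comb (F : StackyFan L r) : (Fin r → ℝ) →ₗ[ℝ] V := Fintype.linearCombination ℝ F.b

theorem comb_apply (F : StackyFan L r) (c : Fin r → ℝ) : F.comb c = ∑ i, c i • F.b i :=
  Fintype.linearCombination_apply ..

theorem sum_smul_b (F : StackyFan L r) (σ : Finset (Fin r)) (c : Fin r → ℝ) :
    ∑ i ∈ σ, c i • F.b i = F.comb (fun i => if i ∈ σ then c i else 0) := by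
  simp [comb_apply, ite_smul]

theorem comb_eq_sum (F : StackyFan L r) {σ : Finset (Fin r)} {c : Fin r → ℝ}
    (h : ∀ i ∉ σ, c i = 0) : F.comb c = ∑ i ∈ σ, c i • F.b i := by
  rw [comb_apply]
  exact (Finset.sum_subset (Finset.subset_univ σ) fun i _ hi => by simp [h i hi]).symm

theorem mem_coneOver_iff (F : StackyFan L r) {σ : Finset (Fin r)} {x : V} :
    x ∈ coneOver F.v σ ↔ ∃ c : Fin r → ℝ, (∀ i, 0 ≤ c i) ∧ (∀ i ∉ σ, c i = 0) ∧ F.comb c = x := by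
  have ha : ∀ i, (0 : ℝ) < F.a i := fun i => by exact_mod_cast F.a_pos i
  constructor
  · rintro ⟨c, hc, rfl⟩
    refine ⟨fun i => if i ∈ σ then c i / F.a i else 0, fun i => ?_, fun i hi => if_neg hi, ?_⟩
    · dsimp only
      split_ifs
      · exact div_nonneg (hc i) (ha i).le
      · exact le_rfl
    · rw [← F.sum_smul_b]
      refine Finset.sum_congr rfl fun i _ => ?_
      rw [b_eq, smul_smul, div_mul_cancel₀ _ (ha i).ne']
  · rintro ⟨c, hc, h, rfl⟩
    refine ⟨fun i => c i * F.a i, fun i => mul_nonneg (hc i) (ha i).le, ?_⟩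
    rw [F.comb_eq_sum h]
    exact Finset.sum_congr rfl fun i _ => by rw [b_eq, smul_smul]

theorem mem_support_iff (F : StackyFan L r) {x : V} :
    x ∈ F.support ↔ ∃ σ ∈ F.cones, ∃ c : Fin r → ℝ,
      (∀ i, 0 ≤ c i) ∧ (∀ i ∉ σ, c i = 0) ∧ F.comb c = x := by
  simp only [support, Set.mem_ofPred_eq, mem_coneOver_iff]

theorem psi_comb (F : StackyFan L r) {σ : Finset (Fin r)} (hσ : σ ∈ F.cones) {c : Fin r → ℝ}
    (hc : ∀ i, 0 ≤ c i) (h : ∀ i ∉ σ, c i = 0) : F.psi (F.comb c) = ∑ i, c i := by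
  rw [F.comb_eq_sum h, F.psi_sum hσ hc]
  exact Finset.sum_subset (Finset.subset_univ σ) fun i _ hi => h i hi

theorem comb_mem_support (F : StackyFan L r) {σ : Finset (Fin r)} (hσ : σ ∈ F.cones)
    {c : Fin r → ℝ} (hc : ∀ i, 0 ≤ c i) (h : ∀ i ∉ σ, c i = 0) : F.comb c ∈ F.support :=
  F.mem_support_iff.2 ⟨σ, hσ, c, hc, h, rfl⟩

theorem psi_nonneg (F : StackyFan L r) {x : V} (hx : x ∈ F.support) : 0 ≤ F.psi x := by
  obtain ⟨σ, hσ, c, hc, h, rfl⟩ := F.mem_support_iff.1 hx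
  rw [F.psi_comb hσ hc h]
  exact Finset.sum_nonneg fun i _ => hc i

theorem psi_eq_zero (F : StackyFan L r) {x : V} (hx : x ∈ F.support) (h0 : F.psi x = 0) :
    x = 0 := by
  obtain ⟨σ, hσ, c, hc, h, rfl⟩ := F.mem_support_iff.1 hx
  rw [F.psi_comb hσ hc h, Finset.sum_eq_zero_iff_of_nonneg fun i _ => hc i] at h0
  rw [show c = 0 from funext fun i => h0 i (Finset.mem_univ i), map_zero]

theorem zero_mem_support (F : StackyFan L r) : (0 : V) ∈ F.support := by
  simpa using F.comb_mem_support F.zero_mem (c := 0) (fun _ => le_rfl) (fun _ _ => rfl)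

theorem psi_zero (F : StackyFan L r) : F.psi 0 = 0 := by
  simpa using F.psi_comb F.zero_mem (c := 0) (fun _ => le_rfl) (fun _ _ => rfl)

theorem smul_mem_support (F : StackyFan L r) {x : V} (hx : x ∈ F.support) {t : ℝ} (ht : 0 ≤ t) :
    t • x ∈ F.support := by
  obtain ⟨σ, hσ, c, hc, h, rfl⟩ := F.mem_support_iff.1 hx
  rw [← map_smul]
  exact F.comb_mem_support hσ (fun i => mul_nonneg ht (hc i)) (fun i hi => by simp [h i hi])

theorem psi_smul (F : StackyFan L r) {x : V} (hx : x ∈ F.support) {t : ℝ} (ht : 0 ≤ t) :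
    F.psi (t • x) = t * F.psi x := by
  obtain ⟨σ, hσ, c, hc, h, rfl⟩ := F.mem_support_iff.1 hx
  rw [← map_smul, F.psi_comb hσ (c := t • c) (fun i => mul_nonneg ht (hc i))
    (fun i hi => by simp [h i hi]), F.psi_comb hσ hc h, Finset.mul_sum]
  rfl

theorem mem_smul_Q_iff (F : StackyFan L r) {x : V} (m : ℕ) :
    x ∈ (m : ℝ) • F.Q ↔ x ∈ F.support ∧ F.psi x ≤ m := by
  rcases Nat.eq_zero_or_pos m with rfl | hm
  -- Here `0 • Q = {0}`, so the claim rests on `ψ` vanishing only at the origin.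
  · have hQ : F.Q.Nonempty := ⟨0, F.zero_mem_support, by simp [F.psi_zero]⟩
    rw [Nat.cast_zero, Set.zero_smul_set hQ]
    constructor
    · rintro rfl
      exact ⟨F.zero_mem_support, F.psi_zero.le⟩
    · rintro ⟨hx, h⟩
      exact F.psi_eq_zero hx (le_antisymm h (F.psi_nonneg hx))
  · have hm' : (0 : ℝ) < m := by exact_mod_cast hm
    rw [Set.mem_smul_set_iff_inv_smul_mem₀ hm'.ne']
    constructor
    · rintro ⟨h1, h2⟩
      have h3 := F.smul_mem_support h1 hm'.le
      have h4 := F.psi_smul h1 hm'.le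
      rw [smul_inv_smul₀ hm'.ne'] at h3 h4
      refine ⟨h3, ?_⟩
      rw [h4]
      nlinarith
    · rintro ⟨h1, h2⟩
      refine ⟨F.smul_mem_support h1 (inv_nonneg.2 hm'.le), ?_⟩
      rw [F.psi_smul h1 (inv_nonneg.2 hm'.le), inv_mul_le_iff₀ hm', mul_one]
      exact h2

/-- A full-dimensional cone of the fan. -/
def IsFull (F : StackyFan L r) (σ : Finset (Fin r)) : Prop :=
  σ ∈ F.cones ∧ σ.card = Module.finrank ℝ V

theorem linearIndepOn_b (F : StackyFan L r) {σ : Finset (Fin r)} (hσ : σ ∈ F.cones) :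
    LinearIndepOn ℝ F.b (σ : Set (Fin r)) := by
  rw [linearIndepOn_finset_iff]
  intro g hg i hi
  have h := linearIndepOn_finset_iff.1 (F.simplicial σ hσ) (fun i => g i * F.a i)
    (by simpa only [b_eq, smul_smul] using hg) i hi
  exact (mul_eq_zero.1 h).resolve_right (by exact_mod_cast (F.a_pos i).ne')

theorem comb_injOn (F : StackyFan L r) {σ : Finset (Fin r)} (hσ : σ ∈ F.cones)
    {c e : Fin r → ℝ} (hc : ∀ i ∉ σ, c i = 0) (he : ∀ i ∉ σ, e i = 0) (h : F.comb c = F.comb e) :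
    c = e := by
  have h0 : F.comb (c - e) = 0 := by rw [map_sub, h, sub_self]
  rw [F.comb_eq_sum (σ := σ) (fun i hi => by simp [hc i hi, he i hi])] at h0
  have h1 := linearIndepOn_finset_iff.1 (F.linearIndepOn_b hσ) _ h0
  ext i
  by_cases hi : i ∈ σ
  · exact sub_eq_zero.1 (h1 i hi)
  · rw [hc i hi, he i hi]

theorem exists_coord (F : StackyFan L r) [FiniteDimensional ℝ V] {σ : Finset (Fin r)}
    (hσ : F.IsFull σ) :
    ∃ l : V →ₗ[ℝ] (Fin r → ℝ), (∀ y, F.comb (l y) = y) ∧ (∀ y, ∀ i ∉ σ, l y i = 0) := by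
  classical
  have hli : LinearIndependent ℝ (fun i : σ => F.b i) := F.linearIndepOn_b hσ.1
  have hspan := hli.span_eq_top_of_card_eq_finrank' (by simpa using hσ.2)
  let B := Module.Basis.mk hli hspan.ge
  refine ⟨LinearMap.pi fun i => if h : i ∈ σ then B.coord ⟨i, h⟩ else 0, fun y => ?_,
    fun y i hi => by simp [hi]⟩
  rw [F.comb_eq_sum (σ := σ) (fun i hi => by simp [hi]), ← Finset.sum_coe_sort]
  conv_rhs => rw [← B.sum_repr y]
  refine Finset.sum_congr rfl fun i _ => ?_
  simp [B]

open Classical in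
/-- The coordinates with respect to the `b_i` in a full-dimensional cone, extended by zero. -/
def coord (F : StackyFan L r) [FiniteDimensional ℝ V] (σ : Finset (Fin r)) :
    V →ₗ[ℝ] (Fin r → ℝ) :=
  if h : F.IsFull σ then (F.exists_coord h).choose else 0

variable [FiniteDimensional ℝ V]

theorem comb_coord (F : StackyFan L r) {σ : Finset (Fin r)} (hσ : F.IsFull σ) (y : V) :
    F.comb (F.coord σ y) = y := by
  rw [coord, dif_pos hσ]
  exact (F.exists_coord hσ).choose_spec.1 y

theorem coord_eq_zero (F : StackyFan L r) {σ : Finset (Fin r)} (y : V)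
    {i : Fin r} (hi : i ∉ σ) : F.coord σ y i = 0 := by
  rw [coord]
  split_ifs with h
  · exact (F.exists_coord h).choose_spec.2 y i hi
  · rfl

theorem coord_comb (F : StackyFan L r) {σ : Finset (Fin r)} (hσ : F.IsFull σ) {c : Fin r → ℝ}
    (hc : ∀ i ∉ σ, c i = 0) : F.coord σ (F.comb c) = c :=
  F.comb_injOn hσ.1 (fun _ hi => F.coord_eq_zero _ hi) hc (F.comb_coord hσ _)

end Algebra

end StackyFan

/-! ### Half-open decomposition of the support. -/

namespace StackyFan

section Algebra

variable {V : Type*} [AddCommGroup V] [Module ℝ V] {L : Submodule ℤ V} {r : ℕ}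

theorem mem_coneOver_iff_coord [FiniteDimensional ℝ V] (F : StackyFan L r) {σ : Finset (Fin r)}
    (hσ : F.IsFull σ) {y : V} : y ∈ coneOver F.v σ ↔ ∀ i ∈ σ, 0 ≤ F.coord σ y i := by
  rw [mem_coneOver_iff]
  constructor
  · rintro ⟨c, hc, h, rfl⟩ i _
    rw [F.coord_comb hσ h]
    exact hc i
  · intro h
    refine ⟨F.coord σ y, fun i => ?_, fun i => F.coord_eq_zero y, F.comb_coord hσ y⟩
    by_cases hi : i ∈ σ
    · exact h i hi
    · rw [F.coord_eq_zero y hi]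

theorem psi_eq_sum_coord [FiniteDimensional ℝ V] (F : StackyFan L r) {σ : Finset (Fin r)}
    (hσ : F.IsFull σ) {y : V} (h : ∀ i ∈ σ, 0 ≤ F.coord σ y i) :
    F.psi y = ∑ i, F.coord σ y i := by
  conv_lhs => rw [← F.comb_coord hσ y]
  refine F.psi_comb hσ.1 (fun i => ?_) (fun i => F.coord_eq_zero y)
  by_cases hi : i ∈ σ
  · exact h i hi
  · rw [F.coord_eq_zero y hi]

theorem mem_support_of_coord [FiniteDimensional ℝ V] (F : StackyFan L r) {σ : Finset (Fin r)}
    (hσ : F.IsFull σ) {y : V} (h : ∀ i ∈ σ, 0 ≤ F.coord σ y i) : y ∈ F.support :=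
  ⟨σ, hσ.1, (F.mem_coneOver_iff_coord hσ).2 h⟩

/-- A point outside the spans of the cones of smaller dimension. -/
def IsGeneric (F : StackyFan L r) (x : V) : Prop :=
  ∀ σ ∈ F.cones, σ.card < Module.finrank ℝ V →
    ∀ c : Fin r → ℝ, (∀ i ∉ σ, c i = 0) → F.comb c ≠ x

theorem IsGeneric.neg {F : StackyFan L r} {x : V} (hx : F.IsGeneric x) : F.IsGeneric (-x) := by
  intro σ hσ hcard c hc h
  refine hx σ hσ hcard (-c) (fun i hi => by simp [hc i hi]) ?_
  rw [map_neg, h, neg_neg]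

theorem card_le_finrank [FiniteDimensional ℝ V] (F : StackyFan L r) {σ : Finset (Fin r)}
    (hσ : σ ∈ F.cones) : σ.card ≤ Module.finrank ℝ V := by
  have h : LinearIndependent ℝ (fun i : σ => F.b i) := F.linearIndepOn_b hσ
  simpa using h.fintype_card_le_finrank


theorem IsGeneric.coord_ne_zero [FiniteDimensional ℝ V]
    {F : StackyFan L r} {x : V} (hx : F.IsGeneric x)
    {σ : Finset (Fin r)} (hσ : F.IsFull σ) {i : Fin r} (hi : i ∈ σ) : F.coord σ x i ≠ 0 := by
  intro h
  refine hx (σ.erase i) (F.face_mem σ hσ.1 _ (Finset.erase_subset i σ)) ?_ (F.coord σ x) ?_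
    (F.comb_coord hσ x)
  · rw [← hσ.2]
    exact Finset.card_erase_lt_of_mem hi
  · intro j hj
    by_cases hji : j = i
    · rw [hji, h]
    · exact F.coord_eq_zero x fun hj' => hj (Finset.mem_erase.2 ⟨hji, hj'⟩)

/-- The cone over `σ` without the facets separating it from `x`. -/
def halfOpenCone [FiniteDimensional ℝ V] (F : StackyFan L r) (x : V) (σ : Finset (Fin r)) : Set V :=
  {y | ∀ i ∈ σ, 0 ≤ F.coord σ y i ∧ (F.coord σ x i < 0 → 0 < F.coord σ y i)}

/-- The only place where convexity itself is invoked: the point is `n + 1` times a convex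
combination of `y` and `x`. -/
theorem add_smul_mem_support (F : StackyFan L r) (hconv : Convex ℝ F.support) {x y : V}
    (hx : x ∈ F.support) (hy : y ∈ F.support) (n : ℕ) : (n : ℝ) • y + x ∈ F.support := by
  have hn : (0 : ℝ) < n + 1 := by positivity
  have h := hconv hy hx (a := n / (n + 1)) (b := 1 / (n + 1)) (by positivity) (by positivity)
    (by field_simp)
  have h' := F.smul_mem_support h hn.le
  rw [smul_add, smul_smul, smul_smul, mul_div_cancel₀ _ hn.ne', mul_div_cancel₀ _ hn.ne',
    one_smul] at h'
  exact h'

/-- By pigeonhole one cone contains `n • y + x` for infinitely many `n`. Large `n` makes the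
coordinates of `y` non-negative, and a zero coordinate of `y` is impossible where that of `x` is
negative. -/
theorem exists_mem_halfOpenCone [FiniteDimensional ℝ V]
    (F : StackyFan L r) (hconv : Convex ℝ F.support) {x y : V}
    (hx : x ∈ F.support) (hgen : F.IsGeneric x) (hy : y ∈ F.support) :
    ∃ σ, F.IsFull σ ∧ y ∈ F.halfOpenCone x σ := by
  choose f hf using fun n : ℕ => F.add_smul_mem_support hconv hx hy n
  obtain ⟨σ, hS⟩ := Finite.exists_infinite_fiber f
  rw [Set.infinite_coe_iff] at hS
  have hmem : ∀ n ∈ f ⁻¹' {σ}, σ ∈ F.cones ∧ (n : ℝ) • y + x ∈ coneOver F.v σ := by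
    rintro n rfl
    exact hf n
  have hσ : σ ∈ F.cones := (hmem _ hS.nonempty.some_mem).1
  have hfull : F.IsFull σ := by
    refine ⟨hσ, (F.card_le_finrank hσ).eq_of_not_lt fun hlt => ?_⟩
    obtain ⟨n, hn, m, hm, hnm⟩ := hS.nontrivial
    obtain ⟨c, -, hc, hc'⟩ := F.mem_coneOver_iff.1 (hmem n hn).2
    obtain ⟨e, -, he, he'⟩ := F.mem_coneOver_iff.1 (hmem m hm).2
    have hne : (n : ℝ) - m ≠ 0 := sub_ne_zero.2 (by exact_mod_cast hnm)
    -- The multiple `n/(n-m)` of the difference of the two points is `n • y`; subtracting it leaves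
    -- `x`, which would then lie in the span of a small cone.
    refine hgen σ hσ hlt (c - ((n : ℝ) / (n - m)) • (c - e))
      (fun i hi => by simp [hc i hi, he i hi]) ?_
    rw [map_sub, map_smul, map_sub, hc', he', add_sub_add_right_eq_sub, ← sub_smul, smul_smul,
      div_mul_cancel₀ _ hne, add_sub_cancel_left]
  have hpos : ∀ n ∈ f ⁻¹' {σ}, ∀ i ∈ σ, 0 ≤ (n : ℝ) * F.coord σ y i + F.coord σ x i := by
    intro n hn i hi
    simpa using (F.mem_coneOver_iff_coord hfull).1 (hmem n hn).2 i hi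
  refine ⟨σ, hfull, fun i hi => ⟨?_, fun hxi => ?_⟩⟩
  · by_contra! h
    obtain ⟨N, hN⟩ := exists_nat_gt (F.coord σ x i / (-F.coord σ y i))
    obtain ⟨n, hn, hnN⟩ := hS.exists_gt N
    rw [div_lt_iff₀ (by linarith)] at hN
    have h1 : (N : ℝ) < n := by exact_mod_cast hnN
    nlinarith [hpos n hn i hi]
  · obtain ⟨n, hn⟩ := hS.nonempty
    have h1 : (0 : ℝ) ≤ n := by positivity
    by_contra! h
    nlinarith [hpos n hn i hi]

/-- A common interior point lies in the common face, so its coordinates outside `σ ∩ τ` vanish. -/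
theorem IsFull.eq_of_pos [FiniteDimensional ℝ V]
    {F : StackyFan L r} {σ τ : Finset (Fin r)} (hσ : F.IsFull σ)
    (hτ : F.IsFull τ) {w : V} (h1 : ∀ i ∈ σ, 0 < F.coord σ w i)
    (h2 : ∀ i ∈ τ, 0 < F.coord τ w i) : σ = τ := by
  have hw : w ∈ coneOver F.v (σ ∩ τ) := by
    rw [← F.inter_eq σ hσ.1 τ hτ.1]
    exact ⟨(F.mem_coneOver_iff_coord hσ).2 fun i hi => (h1 i hi).le,
      (F.mem_coneOver_iff_coord hτ).2 fun i hi => (h2 i hi).le⟩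
  obtain ⟨q, -, hq, rfl⟩ := F.mem_coneOver_iff.1 hw
  rw [F.coord_comb hσ fun i hi => hq i fun h => hi (Finset.mem_inter.1 h).1] at h1
  rw [F.coord_comb hτ fun i hi => hq i fun h => hi (Finset.mem_inter.1 h).2] at h2
  ext i
  constructor
  · exact fun hi => by_contra fun h => (h1 i hi).ne' (hq i fun h' => h (Finset.mem_inter.1 h').2)
  · exact fun hi => by_contra fun h => (h2 i hi).ne' (hq i fun h' => h (Finset.mem_inter.1 h').1)

-- Where the coordinate of `y` is zero, the facet was not deleted, so genericity makes the
-- coordinate of `x` strictly positive.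
open Filter in
theorem IsGeneric.eventually_pos [FiniteDimensional ℝ V]
    {F : StackyFan L r} {x y : V} (hgen : F.IsGeneric x)
    {σ : Finset (Fin r)} (hσ : F.IsFull σ) (hy : y ∈ F.halfOpenCone x σ) :
    ∀ᶠ n : ℕ in atTop, ∀ i ∈ σ, 0 < F.coord σ ((n : ℝ) • y + x) i := by
  rw [Filter.eventually_all_finset]
  intro i hi
  have h : ∀ n : ℕ, F.coord σ ((n : ℝ) • y + x) i = n * F.coord σ y i + F.coord σ x i := by
    simp
  simp only [h]
  rcases (hy i hi).1.eq_or_lt with h0 | h0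
  · have h1 : 0 ≤ F.coord σ x i := by
      by_contra! h2
      exact ((hy i hi).2 h2).ne h0
    have h2 := lt_of_le_of_ne h1 (hgen.coord_ne_zero hσ hi).symm
    exact Filter.Eventually.of_forall fun n => by rwa [← h0, mul_zero, zero_add]
  · exact (tendsto_atTop_add_const_right _ _
      (tendsto_natCast_atTop_atTop.atTop_mul_const h0)).eventually_gt_atTop 0

theorem IsGeneric.halfOpenCone_unique [FiniteDimensional ℝ V]
    {F : StackyFan L r} {x y : V} (hgen : F.IsGeneric x)
    {σ τ : Finset (Fin r)} (hσ : F.IsFull σ) (hτ : F.IsFull τ) (h1 : y ∈ F.halfOpenCone x σ)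
    (h2 : y ∈ F.halfOpenCone x τ) : σ = τ := by
  obtain ⟨n, h3, h4⟩ := ((hgen.eventually_pos hσ h1).and (hgen.eventually_pos hτ h2)).exists
  exact hσ.eq_of_pos hτ h3 h4

/-! ### Tiling the half-open cones by parallelotopes. -/

/-- The half-open fundamental parallelotope of `halfOpenCone`. -/
def halfOpenBox [FiniteDimensional ℝ V] (F : StackyFan L r) (x : V) (σ : Finset (Fin r)) : Set V :=
  {y | ∀ i ∈ σ, 0 ≤ F.coord σ y i ∧ F.coord σ y i ≤ 1 ∧
    (F.coord σ x i < 0 → 0 < F.coord σ y i) ∧ (¬ F.coord σ x i < 0 → F.coord σ y i < 1)}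

/-- The lattice points of the half-open parallelotopes, each with its cone. -/
def boxPoints [FiniteDimensional ℝ V] (F : StackyFan L r) (x : V) : Set (Finset (Fin r) × V) :=
  {p | F.IsFull p.1 ∧ p.2 ∈ L ∧ p.2 ∈ F.halfOpenBox x p.1}

/-- The parameter set of the lattice points of the support. -/
def boxTranslates [FiniteDimensional ℝ V]
    (F : StackyFan L r) (x : V) : Set ((Finset (Fin r) × V) × (Fin r → ℕ)) :=
  {z | z.1 ∈ F.boxPoints x ∧ ∀ i ∉ z.1.1, z.2 i = 0}

/-- The translate of a point of a parallelotope by a natural combination of the `b_i`. -/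
def translate (F : StackyFan L r) (z : (Finset (Fin r) × V) × (Fin r → ℕ)) : V :=
  z.1.2 + F.comb (fun i => (z.2 i : ℝ))

theorem comb_natCast_mem (F : StackyFan L r) (n : Fin r → ℕ) :
    F.comb (fun i => (n i : ℝ)) ∈ L := by
  rw [comb_apply]
  refine L.sum_mem fun i _ => ?_
  rw [Nat.cast_smul_eq_nsmul, b]
  exact L.smul_of_tower_mem _ (L.smul_of_tower_mem _ (F.v_mem i))

theorem coord_translate [FiniteDimensional ℝ V] (F : StackyFan L r) {x : V}
    {z : (Finset (Fin r) × V) × (Fin r → ℕ)} (hz : z ∈ F.boxTranslates x) (i : Fin r) :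
    F.coord z.1.1 (F.translate z) i = F.coord z.1.1 z.1.2 i + z.2 i := by
  rw [translate, map_add, F.coord_comb hz.1.1 fun i hi => by simp [hz.2 i hi]]
  rfl

theorem translate_mem_halfOpenCone [FiniteDimensional ℝ V] (F : StackyFan L r) {x : V}
    {z : (Finset (Fin r) × V) × (Fin r → ℕ)} (hz : z ∈ F.boxTranslates x) :
    F.translate z ∈ F.halfOpenCone x z.1.1 := by
  intro i hi
  rw [F.coord_translate hz]
  obtain ⟨h1, h2, h3, h4⟩ := hz.1.2.2 i hi
  have h5 : (0 : ℝ) ≤ z.2 i := by positivity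
  exact ⟨by positivity, fun h => add_pos_of_pos_of_nonneg (h3 h) h5⟩

theorem psi_translate [FiniteDimensional ℝ V] (F : StackyFan L r) {x : V}
    {z : (Finset (Fin r) × V) × (Fin r → ℕ)} (hz : z ∈ F.boxTranslates x) :
    F.psi (F.translate z) = F.psi z.1.2 + (∑ i ∈ z.1.1, z.2 i : ℕ) := by
  rw [F.psi_eq_sum_coord hz.1.1 fun i hi => (F.translate_mem_halfOpenCone hz i hi).1,
    F.psi_eq_sum_coord hz.1.1 fun i hi => (hz.1.2.2 i hi).1,
    Finset.sum_subset (Finset.subset_univ _) fun i _ hi => hz.2 i hi, Nat.cast_sum,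
    ← Finset.sum_add_distrib]
  exact Finset.sum_congr rfl fun i _ => F.coord_translate hz i

theorem bijOn_translate [FiniteDimensional ℝ V]
    (F : StackyFan L r) (hconv : Convex ℝ F.support) {x : V}
    (hx : x ∈ F.support) (hgen : F.IsGeneric x) :
    Set.BijOn F.translate (F.boxTranslates x) (L ∩ F.support) := by
  refine ⟨fun z hz => ⟨?_, ?_⟩, fun z hz z' hz' h => ?_, fun v hv => ?_⟩
  · exact L.add_mem hz.1.2.1 (F.comb_natCast_mem _)
  · exact F.mem_support_of_coord hz.1.1 fun i hi => (F.translate_mem_halfOpenCone hz i hi).1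
  · have h1 := F.translate_mem_halfOpenCone hz'
    rw [← h] at h1
    have h2 := hgen.halfOpenCone_unique hz.1.1 hz'.1.1 (F.translate_mem_halfOpenCone hz) h1
    obtain ⟨⟨σ, g⟩, n⟩ := z
    obtain ⟨⟨τ, g'⟩, n'⟩ := z'
    obtain rfl : σ = τ := h2
    have hn : n = n' := by
      ext i
      by_cases hi : i ∈ σ
      · have h3 := F.coord_translate hz i
        rw [h, F.coord_translate hz' i] at h3
        obtain ⟨p1, p2, p3, p4⟩ := hz.1.2.2 i hi
        obtain ⟨q1, q2, q3, q4⟩ := hz'.1.2.2 i hi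
        dsimp only at *
        -- Both remainders lie in the same half-open unit interval, `(0,1]` or `[0,1)` according to
        -- the sign of the coordinate of `x`.
        have key : |((n i : ℤ) : ℝ) - ((n' i : ℤ) : ℝ)| < 1 := by
          rw [abs_lt]
          push_cast
          by_cases hs : F.coord σ x i < 0
          · have := p3 hs
            have := q3 hs
            constructor <;> linarith
          · have := p4 hs
            have := q4 hs
            constructor <;> linarith
        rw [← Int.cast_sub, ← Int.cast_abs, ← Int.cast_one, Int.cast_lt, Int.abs_lt_one_iff] at key
        omega
      · exact (hz.2 i hi).trans (hz'.2 i hi).symm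
    subst hn
    simpa [translate] using h
  · obtain ⟨σ, hσ, hvσ⟩ := F.exists_mem_halfOpenCone hconv hx hgen hv.2
    -- On a deleted facet the remainder must lie in `(0,1]`, hence the ceiling minus one in place of
    -- the floor.
    let n : Fin r → ℕ := fun i =>
      if F.coord σ x i < 0 then ⌈F.coord σ v i⌉₊ - 1 else ⌊F.coord σ v i⌋₊
    have hn0 : ∀ i ∉ σ, n i = 0 := fun i hi => by simp [n, F.coord_eq_zero _ hi]
    have hc : ∀ i, F.coord σ (v - F.comb fun i => (n i : ℝ)) i = F.coord σ v i - n i := by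
      intro i
      rw [map_sub, F.coord_comb hσ fun i hi => by simp [hn0 i hi]]
      rfl
    refine ⟨((σ, v - F.comb fun i => (n i : ℝ)), n),
      ⟨⟨hσ, L.sub_mem hv.1 (F.comb_natCast_mem _), fun i hi => ?_⟩, hn0⟩, by simp [translate]⟩
    dsimp only
    rw [hc]
    obtain ⟨h1, h2⟩ := hvσ i hi
    by_cases hs : F.coord σ x i < 0
    · have h3 := h2 hs
      have h4 : 1 ≤ ⌈F.coord σ v i⌉₊ := Nat.one_le_iff_ne_zero.2 (Nat.ceil_pos.2 h3).ne'
      have h5 : (n i : ℝ) = ⌈F.coord σ v i⌉₊ - 1 := by simp [n, hs, Nat.cast_sub h4]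
      have h6 := Nat.le_ceil (F.coord σ v i)
      have h7 := Nat.ceil_lt_add_one h1
      rw [h5]
      exact ⟨by linarith, by linarith, fun _ => by linarith, fun h => absurd hs h⟩
    · have h5 : (n i : ℝ) = ⌊F.coord σ v i⌋₊ := by simp [n, hs]
      have h6 := Nat.floor_le h1
      have h7 := Nat.lt_floor_add_one (F.coord σ v i)
      rw [h5]
      exact ⟨by linarith, by linarith, fun h => absurd h hs, fun _ => by linarith⟩

/-- Lattice points of the support with a condition on `ψ` are counted by parallelotopes. -/
theorem ncard_lattice_eq_sum [FiniteDimensional ℝ V]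
    (F : StackyFan L r) (hconv : Convex ℝ F.support) {x : V}
    (hx : x ∈ F.support) (hgen : F.IsGeneric x) (hfin : (F.boxPoints x).Finite) (P : ℝ → Prop)
    (T : Finset (Fin r) × V → Finset (Fin r → ℕ))
    (hT : ∀ p ∈ F.boxPoints x, ∀ n : Fin r → ℕ, n ∈ T p ↔
      (∀ i ∉ p.1, n i = 0) ∧ P (F.psi p.2 + (∑ i ∈ p.1, n i : ℕ))) :
    {v | v ∈ L ∧ v ∈ F.support ∧ P (F.psi v)}.Finite ∧
    {v | v ∈ L ∧ v ∈ F.support ∧ P (F.psi v)}.ncard = ∑ p ∈ hfin.toFinset, (T p).card := by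
  have hbij := F.bijOn_translate hconv hx hgen
  have himage : {v | v ∈ L ∧ v ∈ F.support ∧ P (F.psi v)} =
      (fun z : (_ : Finset (Fin r) × V) × (Fin r → ℕ) => F.translate (z.1, z.2)) ''
        (hfin.toFinset.sigma T : Set ((_ : Finset (Fin r) × V) × (Fin r → ℕ))) := by
    ext v
    simp only [Set.mem_ofPred_eq, Set.mem_image, Finset.mem_coe, Finset.mem_sigma,
      Set.Finite.mem_toFinset]
    constructor
    · rintro ⟨h1, h2, h3⟩
      obtain ⟨z, hz, rfl⟩ := hbij.surjOn ⟨h1, h2⟩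
      rw [F.psi_translate hz] at h3
      exact ⟨⟨z.1, z.2⟩, ⟨hz.1, (hT _ hz.1 _).2 ⟨hz.2, h3⟩⟩, rfl⟩
    · rintro ⟨⟨p, n⟩, ⟨hp, hn⟩, rfl⟩
      obtain ⟨h1, h2⟩ := (hT p hp n).1 hn
      have hz : (p, n) ∈ F.boxTranslates x := ⟨hp, h1⟩
      obtain ⟨h3, h4⟩ := hbij.mapsTo hz
      refine ⟨h3, h4, ?_⟩
      rw [F.psi_translate hz]
      exact h2
  have hinj : Set.InjOn
      (fun z : (_ : Finset (Fin r) × V) × (Fin r → ℕ) => F.translate (z.1, z.2))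
      (hfin.toFinset.sigma T : Set ((_ : Finset (Fin r) × V) × (Fin r → ℕ))) := by
    rintro ⟨p, n⟩ hz ⟨p', n'⟩ hz' h
    simp only [Finset.mem_coe, Finset.mem_sigma, Set.Finite.mem_toFinset] at hz hz'
    have := hbij.injOn (x₁ := (p, n)) (x₂ := (p', n')) ⟨hz.1, ((hT p hz.1 n).1 hz.2).1⟩
      ⟨hz'.1, ((hT p' hz'.1 n').1 hz'.2).1⟩ h
    obtain ⟨rfl, rfl⟩ := Prod.mk.inj this
    rfl
  rw [himage]
  refine ⟨(Finset.finite_toSet _).image _, ?_⟩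
  rw [hinj.ncard_image, Set.ncard_coe_finset, Finset.card_sigma]

end Algebra

end StackyFan

/-! ### Lattice points and normalised volume. -/

section Lattice

open MeasureTheory Filter Topology

theorem finite_inter_of_isBounded {V : Type*} [NormedAddCommGroup V] [NormedSpace ℝ V]
    [FiniteDimensional ℝ V] (L : Submodule ℤ V) [hL : DiscreteTopology L] {K : Set V}
    (hK : Bornology.IsBounded K) : (K ∩ L).Finite := by
  have : ProperSpace V := FiniteDimensional.proper ℝ V
  change (K ∩ L.toAddSubgroup).Finite
  have : DiscreteTopology L.toAddSubgroup := hL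
  exact Metric.finite_isBounded_inter_isClosed DiscreteTopology.isDiscrete hK inferInstance

variable {V : Type*} [NormedAddCommGroup V] [NormedSpace ℝ V] [FiniteDimensional ℝ V]
  [MeasurableSpace V] [BorelSpace V] (L : Submodule ℤ V) [DiscreteTopology L] [IsZLattice ℝ L]

/-- Lebesgue measure transported along a lattice basis is a Haar measure giving the fundamental
domain mass 1. Any other Haar measure is a multiple of it, and the factor cancels in the quotient by
the covolume. -/
theorem volume_image_equivFun_eq_latticeVolume {ι : Type*} [Fintype ι]
    (b : Module.Basis ι ℤ L) (s : Set V) (hs : MeasurableSet s) :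
    (volume : Measure (ι → ℝ)).real ((b.ofZLatticeBasis ℝ).equivFun '' s) = latticeVolume L s := by
  let B := b.ofZLatticeBasis ℝ L
  let e : (ι → ℝ) ≃L[ℝ] V := B.equivFunL.symm
  let ν : Measure V := (volume : Measure (ι → ℝ)).map e
  have hν : ν.IsAddHaarMeasure := e.isAddHaarMeasure_map volume
  have hνs : ∀ t, MeasurableSet t → ν.real t = (volume : Measure (ι → ℝ)).real (B.equivFun '' t) := by
    intro t ht
    rw [measureReal_def, Measure.map_apply e.continuous.measurable ht, measureReal_def,
      LinearEquiv.image_eq_preimage_symm]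
    rfl
  have hfd : ν.real (ZSpan.fundamentalDomain B) = 1 := by
    rw [hνs _ (ZSpan.fundamentalDomain_measurableSet _)]
    have : B.equivFun '' ZSpan.fundamentalDomain B = Set.univ.pi fun _ => Set.Ico (0 : ℝ) 1 := by
      rw [LinearEquiv.image_eq_preimage_symm]
      ext c
      have hc : ∀ i, B.repr (B.equivFun.symm c) i = c i := fun i => by
        rw [← Module.Basis.equivFun_apply, LinearEquiv.apply_symm_apply]
      simp only [Set.mem_preimage, ZSpan.mem_fundamentalDomain, hc, Set.mem_pi, Set.mem_univ,
        true_implies]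
    rw [this, measureReal_def, Real.volume_pi_Ico]
    simp
  have hscale := Measure.isAddLeftInvariant_eq_smul (Measure.addHaar : Measure V) ν
  have hcov := ZLattice.covolume_eq_measure_fundamentalDomain L (Measure.addHaar : Measure V)
    (ZLattice.isAddFundamentalDomain b Measure.addHaar)
  have hne := ZLattice.covolume_ne_zero L (Measure.addHaar : Measure V)
  rw [latticeVolume, ← hνs s hs]
  rw [eq_div_iff hne, hcov]
  rw [hscale, measureReal_nnreal_smul_apply, measureReal_nnreal_smul_apply, hfd]
  ring

theorem tendsto_card_lattice_div_pow {s : Set V} (hs₁ : Bornology.IsBounded s)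
    (hs₂ : MeasurableSet s) (hs₃ : (Measure.addHaar : Measure V) (frontier s) = 0) :
    Tendsto (fun n : ℕ => (Nat.card (s ∩ (n : ℝ)⁻¹ • (L : Set V) : Set V) : ℝ) /
      n ^ Module.finrank ℝ V) atTop (𝓝 (latticeVolume L s)) := by
  let b := Module.Free.chooseBasis ℤ L
  rw [← volume_image_equivFun_eq_latticeVolume L b s hs₂]
  convert ZLattice.covolume.tendsto_card_div_pow'' b hs₁ hs₂ ?_ using 4
  · rw [← Module.finrank_eq_card_chooseBasisIndex, ZLattice.rank ℝ L]
  · let e : V ≃L[ℝ] (Module.Free.ChooseBasisIndex ℤ L → ℝ) := (b.ofZLatticeBasis ℝ L).equivFunL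
    have hfr : frontier ((b.ofZLatticeBasis ℝ L).equivFun '' s) =
        (b.ofZLatticeBasis ℝ L).equivFun '' frontier s :=
      (e.toHomeomorph.image_frontier s).symm
    have h := volume_image_equivFun_eq_latticeVolume L b _ (isClosed_frontier (s := s)).measurableSet
    rw [latticeVolume, measureReal_def, measureReal_def, hs₃, ENNReal.toReal_zero, zero_div,
      ENNReal.toReal_eq_zero_iff] at h
    rw [hfr]
    refine h.resolve_right ?_
    refine (Bornology.IsBounded.measure_lt_top ?_).ne
    have : ProperSpace V := FiniteDimensional.proper ℝ V
    have hc : IsCompact (frontier s) := Metric.isCompact_of_isClosed_isBounded isClosed_frontier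
      (hs₁.closure.subset frontier_subset_closure)
    exact (hc.image e.continuous).isBounded

end Lattice

/-! ### Finiteness, rationality, generic points, and the geometry of `Q`. -/

namespace StackyFan

open MeasureTheory Filter Topology

variable {V : Type*} [NormedAddCommGroup V] [NormedSpace ℝ V] {L : Submodule ℤ V} {r : ℕ}

theorem isCompact_comb_unitCube (F : StackyFan L r) :
    IsCompact (F.comb '' Set.Icc 0 1) :=
  isCompact_Icc.image F.comb.continuous_of_finiteDimensional

theorem mem_comb_unitCube [FiniteDimensional ℝ V]
    (F : StackyFan L r) {σ : Finset (Fin r)} (hσ : F.IsFull σ) {y : V}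
    (h0 : ∀ i ∈ σ, 0 ≤ F.coord σ y i) (h1 : ∀ i ∈ σ, F.coord σ y i ≤ 1) :
    y ∈ F.comb '' Set.Icc 0 1 := by
  refine ⟨F.coord σ y, ⟨fun i => ?_, fun i => ?_⟩, F.comb_coord hσ y⟩ <;>
  by_cases hi : i ∈ σ
  · exact h0 i hi
  · rw [F.coord_eq_zero y hi]; rfl
  · exact h1 i hi
  · rw [F.coord_eq_zero y hi]; exact zero_le_one

theorem finite_boxPoints [FiniteDimensional ℝ V] (F : StackyFan L r) [DiscreteTopology L] (x : V) :
    (F.boxPoints x).Finite := by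
  refine (Set.finite_univ.prod
    (finite_inter_of_isBounded L F.isCompact_comb_unitCube.isBounded)).subset ?_
  rintro ⟨σ, g⟩ ⟨h1, h2, h3⟩
  exact ⟨trivial, F.mem_comb_unitCube h1 (fun i hi => (h3 i hi).1) fun i hi => (h3 i hi).2.1, h2⟩

/-- Reduce the multiples `k • v` modulo the `b_i`. The results are lattice points in a bounded set,
so two of them agree, and the corresponding multiple of each coordinate is an integer. -/
theorem exists_rat_coord [FiniteDimensional ℝ V]
    (F : StackyFan L r) [DiscreteTopology L] {σ : Finset (Fin r)}
    (hσ : F.IsFull σ) {v : V} (hv : v ∈ L) : ∃ c : Fin r → ℚ, ∀ i, F.coord σ v i = c i := by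
  have hfl : ∀ (k : ℕ), ∀ i ∉ σ, ((⌊k * F.coord σ v i⌋ : ℤ) : ℝ) = 0 := by
    intro k i hi
    simp [F.coord_eq_zero v hi]
  let y : ℕ → V := fun k => k • v - F.comb fun i => ((⌊k * F.coord σ v i⌋ : ℤ) : ℝ)
  have hy : ∀ k i, F.coord σ (y k) i = Int.fract (k * F.coord σ v i) := by
    intro k i
    simp only [y]
    rw [map_sub, F.coord_comb hσ (hfl k), map_nsmul]
    simp only [Pi.sub_apply, nsmul_eq_mul]
    rfl
  have hmaps : Set.MapsTo y Set.univ (F.comb '' Set.Icc 0 1 ∩ L) := by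
    intro k _
    refine ⟨F.mem_comb_unitCube hσ (fun i _ => ?_) fun i _ => ?_, ?_⟩
    · rw [hy]; exact Int.fract_nonneg _
    · rw [hy]; exact (Int.fract_lt_one _).le
    · refine L.sub_mem (L.smul_of_tower_mem k hv) ?_
      rw [comb_apply]
      refine L.sum_mem fun i _ => ?_
      rw [Int.cast_smul_eq_zsmul, b]
      exact L.smul_mem _ (L.smul_of_tower_mem _ (F.v_mem i))
  obtain ⟨k, -, m, -, hkm, heq⟩ := Set.infinite_univ.exists_ne_map_eq_of_mapsTo hmaps
    (finite_inter_of_isBounded L F.isCompact_comb_unitCube.isBounded)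
  have hne : (k : ℝ) - m ≠ 0 := sub_ne_zero.2 (by exact_mod_cast hkm)
  refine ⟨fun i => ((⌊k * F.coord σ v i⌋ - ⌊m * F.coord σ v i⌋ : ℤ) : ℚ) / ((k : ℚ) - m),
    fun i => ?_⟩
  have h := congrArg (fun w => F.coord σ w i) heq
  simp only [hy, Int.fract] at h
  push_cast
  rw [eq_div_iff hne]
  linarith

/-- The interior of a full cone has positive measure, while the finitely many spans to be avoided
are null. -/
theorem exists_isGeneric [FiniteDimensional ℝ V]
    [MeasurableSpace V] [BorelSpace V] (F : StackyFan L r)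
    (hdim : ∃ σ, F.IsFull σ) : ∃ x ∈ F.support, F.IsGeneric x := by
  obtain ⟨σ, hσ⟩ := hdim
  let U : Set V := {y | ∀ i ∈ σ, 0 < F.coord σ y i}
  have hU : IsOpen U := by
    have : U = ⋂ i ∈ σ, {y | 0 < F.coord σ y i} := by
      ext
      simp [U]
    rw [this]
    refine isOpen_biInter_finset fun i _ => ?_
    exact isOpen_lt continuous_const
      ((continuous_apply i).comp (F.coord σ).continuous_of_finiteDimensional)
  have hne : U.Nonempty := by
    refine ⟨F.comb fun i => if i ∈ σ then 1 else 0, fun i hi => ?_⟩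
    rw [F.coord_comb hσ fun j hj => if_neg hj]
    simp [hi]
  let bad : Set V := ⋃ τ ∈ {τ : Finset (Fin r) | τ ∈ F.cones ∧ τ.card < Module.finrank ℝ V},
    (Submodule.span ℝ (F.b '' (τ : Set (Fin r))) : Set V)
  have hbad : (Measure.addHaar : Measure V) bad = 0 := by
    refine (measure_biUnion_null_iff (Set.to_countable _)).2 fun τ hτ => ?_
    refine Measure.addHaar_submodule _ _ fun htop => ?_
    classical
    have h1 := finrank_span_finset_le_card (R := ℝ) (τ.image F.b)
    rw [Set.finrank, Finset.coe_image, htop, finrank_top] at h1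
    exact absurd (h1.trans Finset.card_image_le) (not_le.2 hτ.2)
  obtain ⟨x, hxU, hxb⟩ : ∃ x ∈ U, x ∉ bad := by
    by_contra! h
    exact (hU.measure_pos Measure.addHaar hne).ne' (measure_mono_null h hbad)
  refine ⟨x, F.mem_support_of_coord hσ fun i hi => (hxU i hi).le, fun τ hτ hcard c hc hcx => hxb ?_⟩
  refine Set.mem_biUnion (show τ ∈ _ from ⟨hτ, hcard⟩) ?_
  rw [← hcx, F.comb_eq_sum hc]
  exact Submodule.sum_mem _ fun i hi =>
    Submodule.smul_mem _ _ (Submodule.subset_span (Set.mem_image_of_mem _ hi))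

theorem Q_eq_biUnion (F : StackyFan L r) :
    F.Q = ⋃ σ ∈ F.cones, F.comb ''
      {c | (∀ i, 0 ≤ c i) ∧ (∀ i ∉ σ, c i = 0) ∧ ∑ i, c i ≤ 1} := by
  ext x
  simp only [Set.mem_iUnion, Set.mem_image, Set.mem_ofPred_eq, exists_prop]
  constructor
  · rintro ⟨hx, h⟩
    obtain ⟨σ, hσ, c, hc, hc0, rfl⟩ := F.mem_support_iff.1 hx
    rw [F.psi_comb hσ hc hc0] at h
    exact ⟨σ, hσ, c, ⟨hc, hc0, h⟩, rfl⟩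
  · rintro ⟨σ, hσ, c, ⟨hc, hc0, h⟩, rfl⟩
    refine ⟨F.comb_mem_support hσ hc hc0, ?_⟩
    rwa [F.psi_comb hσ hc hc0]

theorem isCompact_convex_simplex (F : StackyFan L r) (σ : Finset (Fin r)) :
    IsCompact (F.comb '' {c | (∀ i, 0 ≤ c i) ∧ (∀ i ∉ σ, c i = 0) ∧ ∑ i, c i ≤ 1}) ∧
    Convex ℝ (F.comb '' {c | (∀ i, 0 ≤ c i) ∧ (∀ i ∉ σ, c i = 0) ∧ ∑ i, c i ≤ 1}) := by
  constructor
  · refine IsCompact.image ?_ F.comb.continuous_of_finiteDimensional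
    refine (isCompact_Icc (a := (0 : Fin r → ℝ)) (b := 1)).of_isClosed_subset ?_ ?_
    · have h1 : IsClosed {c : Fin r → ℝ | ∀ i, 0 ≤ c i} := by
        simp only [Set.ofPred_forall]
        exact isClosed_iInter fun i => isClosed_le continuous_const (continuous_apply i)
      have h2 : IsClosed {c : Fin r → ℝ | ∀ i ∉ σ, c i = 0} := by
        simp only [Set.ofPred_forall]
        exact isClosed_iInter fun i => isClosed_iInter fun _ =>
          isClosed_eq (continuous_apply i) continuous_const
      have h3 : IsClosed {c : Fin r → ℝ | ∑ i, c i ≤ 1} :=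
        isClosed_le (by fun_prop) continuous_const
      exact h1.inter (h2.inter h3)
    · rintro c ⟨h1, -, h3⟩
      exact ⟨h1, fun i =>
        (Finset.single_le_sum (fun j _ => h1 j) (Finset.mem_univ i)).trans h3⟩
  · refine Convex.linear_image ?_ F.comb
    rintro c ⟨h1, h2, h3⟩ e ⟨k1, k2, k3⟩ s t hs ht hst
    refine ⟨fun i => ?_, fun i hi => by simp [h2 i hi, k2 i hi], ?_⟩
    · exact add_nonneg (mul_nonneg hs (h1 i)) (mul_nonneg ht (k1 i))
    · simp only [Pi.add_apply, Pi.smul_apply, smul_eq_mul, Finset.sum_add_distrib,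
        ← Finset.mul_sum]
      nlinarith

theorem isCompact_Q (F : StackyFan L r) : IsCompact F.Q := by
  rw [Q_eq_biUnion]
  exact (Set.toFinite F.cones).isCompact_biUnion fun σ _ => (F.isCompact_convex_simplex σ).1

theorem frontier_biUnion_subset {X ι : Type*} [TopologicalSpace X] {t : Set ι} (ht : t.Finite)
    (s : ι → Set X) : frontier (⋃ i ∈ t, s i) ⊆ ⋃ i ∈ t, frontier (s i) := by
  intro x hx
  rw [frontier, ht.closure_biUnion] at hx
  obtain ⟨h1, h2⟩ := hx
  simp only [Set.mem_iUnion, exists_prop] at h1 ⊢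
  obtain ⟨i, hi, hxi⟩ := h1
  exact ⟨i, hi, hxi, fun h => h2 (interior_mono (Set.subset_biUnion_of_mem hi) h)⟩

/-- `Q` need not be convex, but it is a finite union of convex simplices, whose frontiers are null.
-/
theorem addHaar_frontier_Q [FiniteDimensional ℝ V]
    [MeasurableSpace V] [BorelSpace V] (F : StackyFan L r) :
    (Measure.addHaar : Measure V) (frontier F.Q) = 0 := by
  rw [Q_eq_biUnion]
  refine measure_mono_null (frontier_biUnion_subset (Set.toFinite _) _) ?_
  exact (measure_biUnion_null_iff (Set.to_countable _)).2 fun σ _ =>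
    (F.isCompact_convex_simplex σ).2.addHaar_frontier _

theorem tendsto_ncard_div_pow [FiniteDimensional ℝ V]
    [MeasurableSpace V] [BorelSpace V] [DiscreteTopology L]
    [IsZLattice ℝ L] (F : StackyFan L r) :
    Tendsto (fun m : ℕ => ({v | v ∈ L ∧ v ∈ F.support ∧ F.psi v ≤ m}.ncard : ℝ) /
      (m : ℝ) ^ Module.finrank ℝ V) atTop (𝓝 (latticeVolume L F.Q)) := by
  refine (tendsto_card_lattice_div_pow L F.isCompact_Q.isBounded
    F.isCompact_Q.measurableSet F.addHaar_frontier_Q).congr' ?_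
  filter_upwards [eventually_gt_atTop 0] with m hm
  have hm' : (m : ℝ) ≠ 0 := by exact_mod_cast hm.ne'
  congr 2
  rw [Nat.card_coe_set_eq, 
    ← Set.ncard_image_of_injective (F.Q ∩ (m : ℝ)⁻¹ • (L : Set V)) (smul_right_injective V hm')]
  congr 1
  rw [Set.image_smul, Set.smul_set_inter₀ hm', smul_inv_smul₀ hm']
  ext v
  rw [Set.mem_inter_iff, F.mem_smul_Q_iff]
  exact and_comm.trans Iff.rfl

end StackyFan

open Filter Topology in
theorem tendsto_choose_add_sub_div_pow (d c : ℕ) :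
    Tendsto (fun m : ℕ => (((d + (m - c)).choose d : ℕ) : ℝ) / (m : ℝ) ^ d) atTop
      (𝓝 (1 / (d.factorial : ℝ))) := by
  have hg : Tendsto (fun m : ℕ => d + (m - c)) atTop atTop :=
    tendsto_atTop_mono (fun m => Nat.le_add_left (m - c) d) (tendsto_sub_atTop_nat c)
  have h1 := ((isEquivalent_choose d).comp_tendsto hg).mul
    (Asymptotics.IsEquivalent.refl (u := fun m : ℕ => ((m : ℝ) ^ d)⁻¹))
  refine h1.symm.tendsto_nhds ?_
  have h2 : Tendsto (fun m : ℕ => 1 + ((d : ℝ) - c) / m) atTop (𝓝 (1 + 0)) :=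
    tendsto_const_nhds.add (tendsto_const_div_atTop_nhds_zero_nat _)
  have h3 := (h2.pow d).div_const (d.factorial : ℝ)
  rw [add_zero, one_pow] at h3
  refine h3.congr' ?_
  filter_upwards [eventually_ge_atTop c, eventually_gt_atTop 0] with m hm hm0
  have hm' : (m : ℝ) ≠ 0 := by exact_mod_cast hm0.ne'
  have h4 : 1 + ((d : ℝ) - c) / m = (d + (m - c : ℕ) : ℕ) / m := by
    rw [Nat.cast_add, Nat.cast_sub hm]
    field_simp
    ring
  rw [h4, div_pow]
  simp only [Pi.mul_apply, Function.comp_apply]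
  ring

/-! ### Counting by height, and the coefficients of `δ⁰`. -/

namespace StackyFan

open MeasureTheory Filter Topology

variable {V : Type*} [NormedAddCommGroup V] [NormedSpace ℝ V] {L : Submodule ℤ V} {r : ℕ}

/-- Every point of the support lies in some full cone, so the outer facets fill the whole level set.
-/
theorem outerBoundary_eq [FiniteDimensional ℝ V]
    (F : StackyFan L r) (hconv : Convex ℝ F.support) {x : V}
    (hx : x ∈ F.support) (hgen : F.IsGeneric x) :
    F.outerBoundary = {v | v ∈ F.support ∧ F.psi v = 1} := by
  classical
  ext v
  constructor
  · rintro ⟨σ, hσ, -, hv⟩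
    have hconvex : Convex ℝ {w | ∃ c : Fin r → ℝ,
        (∀ i, 0 ≤ c i) ∧ (∀ i ∉ σ, c i = 0) ∧ ∑ i, c i = 1 ∧ F.comb c = w} := by
      rintro _ ⟨c, h1, h2, h3, rfl⟩ _ ⟨e, k1, k2, k3, rfl⟩ s t hs ht hst
      refine ⟨s • c + t • e, fun i => add_nonneg (mul_nonneg hs (h1 i)) (mul_nonneg ht (k1 i)),
        fun i hi => by simp [h2 i hi, k2 i hi], ?_, by simp⟩
      simp only [Pi.add_apply, Pi.smul_apply, smul_eq_mul, Finset.sum_add_distrib,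
        ← Finset.mul_sum, h3, k3, mul_one, hst]
    obtain ⟨c, h1, h2, h3, rfl⟩ := convexHull_min (t := {w | ∃ c : Fin r → ℝ,
        (∀ i, 0 ≤ c i) ∧ (∀ i ∉ σ, c i = 0) ∧ ∑ i, c i = 1 ∧ F.comb c = w}) (by
      rintro _ ⟨i, hi, rfl⟩
      refine ⟨Pi.single i 1, fun j => ?_, fun j hj => ?_, by simp, ?_⟩
      · by_cases hji : j = i
        · subst hji; simp
        · simp [hji]
      · refine Pi.single_eq_of_ne ?_ 1
        rintro rfl
        exact hj hi
      · rw [comb, Fintype.linearCombination_apply_single, one_smul]) hconvex hv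
    exact ⟨F.comb_mem_support hσ h1 h2, (F.psi_comb hσ h1 h2).trans h3⟩
  · rintro ⟨h1, h2⟩
    obtain ⟨σ, hσ, hvσ⟩ := F.exists_mem_halfOpenCone hconv hx hgen h1
    refine ⟨σ, hσ.1, hσ.2, ?_⟩
    rw [F.psi_eq_sum_coord hσ fun i hi => (hvσ i hi).1,
      ← Finset.sum_subset (Finset.subset_univ σ) fun i _ hi => F.coord_eq_zero v hi] at h2
    rw [← F.comb_coord hσ v, F.comb_eq_sum fun i hi => F.coord_eq_zero v hi]
    exact (convex_convexHull ℝ _).sum_mem (fun i hi => (hvσ i hi).1) h2 fun i hi =>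
      subset_convexHull ℝ _ (Set.mem_image_of_mem _ hi)

open Classical in
/-- The rational value of `ψ` at a lattice point. -/
def ratPsi (F : StackyFan L r) (v : V) : ℚ :=
  if h : ∃ q : ℚ, F.psi v = q then h.choose else 0

variable [FiniteDimensional ℝ V] [DiscreteTopology L]

theorem psi_eq_ratPsi (F : StackyFan L r) {σ : Finset (Fin r)} (hσ : F.IsFull σ) {v : V}
    (hv : v ∈ L) (h0 : ∀ i ∈ σ, 0 ≤ F.coord σ v i) : F.psi v = F.ratPsi v := by
  have h : ∃ q : ℚ, F.psi v = q := by
    obtain ⟨c, hc⟩ := F.exists_rat_coord hσ hv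
    refine ⟨∑ i, c i, ?_⟩
    rw [F.psi_eq_sum_coord hσ h0, Rat.cast_sum]
    exact Finset.sum_congr rfl fun i _ => hc i
  rw [ratPsi, dif_pos h]
  exact h.choose_spec

theorem psi_boxPoint (F : StackyFan L r) {x : V} {p : Finset (Fin r) × V}
    (hp : p ∈ F.boxPoints x) : F.psi p.2 = F.ratPsi p.2 ∧ 0 ≤ F.psi p.2 ∧
      F.psi p.2 ≤ Module.finrank ℝ V := by
  have h0 : ∀ i ∈ p.1, 0 ≤ F.coord p.1 p.2 i := fun i hi => (hp.2.2 i hi).1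
  refine ⟨F.psi_eq_ratPsi hp.1 hp.2.1 h0, F.psi_nonneg (F.mem_support_of_coord hp.1 h0), ?_⟩
  rw [F.psi_eq_sum_coord hp.1 h0, ← hp.1.2,
    ← Finset.sum_subset (Finset.subset_univ p.1) fun i _ hi => F.coord_eq_zero p.2 hi]
  simpa using Finset.sum_le_card_nsmul p.1 _ 1 fun i hi => (hp.2.2 i hi).2.1

/-- The finset of lattice points of the half-open parallelotopes. -/
def boxFinset (F : StackyFan L r) (x : V) : Finset (Finset (Fin r) × V) :=
  (F.finite_boxPoints x).toFinset

theorem mem_boxFinset (F : StackyFan L r) {x : V} {p : Finset (Fin r) × V} :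
    p ∈ F.boxFinset x ↔ p ∈ F.boxPoints x := Set.Finite.mem_toFinset _

/-- The number of lattice points of given height in the half-open parallelotopes. -/
def boxVector (F : StackyFan L r) (x : V) : ℚ →₀ ℕ :=
  ∑ p ∈ F.boxFinset x, Finsupp.single (F.ratPsi p.2) 1

theorem boxVector_apply (F : StackyFan L r) (x : V) (q : ℚ) :
    F.boxVector x q = ∑ p ∈ F.boxFinset x, if F.psi p.2 = q then 1 else 0 := by
  rw [boxVector, Finsupp.finsetSum_apply]
  refine Finset.sum_congr rfl fun p hp => ?_
  rw [Finsupp.single_apply, (F.psi_boxPoint (F.mem_boxFinset.1 hp)).1]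
  simp only [Rat.cast_inj]

theorem boxVector_bounds (F : StackyFan L r) (x : V) {q : ℚ} (hq : q ∈ (F.boxVector x).support) :
    0 ≤ q ∧ q ≤ (Module.finrank ℝ V : ℚ) := by
  rw [Finsupp.mem_support_iff, boxVector_apply] at hq
  obtain ⟨p, hp, h⟩ := Finset.exists_ne_zero_of_sum_ne_zero hq
  have h1 : F.psi p.2 = q := by_contra fun h' => h (if_neg h')
  have h2 := F.psi_boxPoint (F.mem_boxFinset.1 hp)
  rw [h1] at h2
  exact ⟨by exact_mod_cast h2.2.1, by exact_mod_cast h2.2.2⟩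

theorem ratPolyEval_boxVector (F : StackyFan L r) (x : V) :
    ratPolyEval (F.boxVector x) 1 = (F.boxFinset x).card := by
  rw [ratPolyEval, boxVector, ← Finsupp.sum_finsetSum_index (by simp) (by simp)]
  simp

/-- Since `P` is invariant under natural shifts, it only sees the box point. The sum of the `n_i`
being an integer, the height bound reads `⌈ψ(g)⌉ + ∑ n_i ≤ m`. -/
theorem ncard_psi_le (F : StackyFan L r) (hconv : Convex ℝ F.support) {x : V}
    (hx : x ∈ F.support) (hgen : F.IsGeneric x) (m : ℕ) (P : ℝ → Prop) [DecidablePred P]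
    (hP : ∀ (y : ℝ) (n : ℕ), P (y + n) ↔ P y) :
    {v | v ∈ L ∧ v ∈ F.support ∧ (F.psi v ≤ m ∧ P (F.psi v))}.ncard =
      ∑ p ∈ F.boxFinset x, if P (F.psi p.2) then
        (if ⌈F.psi p.2⌉₊ ≤ m then
          (Module.finrank ℝ V + (m - ⌈F.psi p.2⌉₊)).choose (Module.finrank ℝ V) else 0)
        else 0 := by
  have h := (F.ncard_lattice_eq_sum hconv hx hgen (F.finite_boxPoints x)
    (fun y => y ≤ m ∧ P y)
    (fun p => if P (F.psi p.2) then
      (if ⌈F.psi p.2⌉₊ ≤ m then p.1.piSumLe (m - ⌈F.psi p.2⌉₊) else ∅) else ∅) ?_).2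
  · rw [h]
    refine Finset.sum_congr rfl fun p hp => ?_
    split_ifs
    · rw [Finset.card_piSumLe, ((Set.Finite.mem_toFinset _).1 hp).1.2]
    · rfl
    · rfl
  · intro p hp n
    obtain ⟨-, h0, -⟩ := F.psi_boxPoint hp
    have key : F.psi p.2 + (∑ i ∈ p.1, n i : ℕ) ≤ m ↔
        ⌈F.psi p.2⌉₊ + ∑ i ∈ p.1, n i ≤ m := by
      rw [← Nat.ceil_add_natCast h0, Nat.ceil_le]
    rw [hP, key]
    split_ifs with h1 h2
    · rw [Finset.mem_piSumLe]
      refine and_congr_right fun _ => ?_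
      constructor
      · exact fun h => ⟨by omega, h1⟩
      · rintro ⟨h, -⟩
        omega
    · simp only [Finset.notMem_empty, false_iff]
      rintro ⟨-, h, -⟩
      omega
    · simp only [Finset.notMem_empty, false_iff]
      exact fun h => h1 h.2.2

theorem ncard_psi_eq (F : StackyFan L r) (hconv : Convex ℝ F.support) {x : V}
    (hx : x ∈ F.support) (hgen : F.IsGeneric x) {l : ℚ} (hl : l < 1) :
    {v | v ∈ L ∧ v ∈ F.support ∧ F.psi v = l}.Finite ∧
    {v | v ∈ L ∧ v ∈ F.support ∧ F.psi v = l}.ncard = F.boxVector x l := by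
  classical
  have hl' : (l : ℝ) < 1 := by exact_mod_cast hl
  have h := F.ncard_lattice_eq_sum hconv hx hgen (F.finite_boxPoints x) (fun y => y = l)
    (fun p => if F.psi p.2 = l then {0} else ∅) ?_
  · refine ⟨h.1, h.2.trans ?_⟩
    rw [boxVector_apply]
    refine Finset.sum_congr rfl fun p hp => ?_
    split_ifs <;> rfl
  · intro p hp n
    obtain ⟨-, h0, -⟩ := F.psi_boxPoint hp
    have key : (∀ i ∉ p.1, n i = 0) ∧ F.psi p.2 + (∑ i ∈ p.1, n i : ℕ) = l ↔
        n = 0 ∧ F.psi p.2 = l := by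
      constructor
      · rintro ⟨h1, h2⟩
        have h3 : ∑ i ∈ p.1, n i = 0 := by
          have : ((∑ i ∈ p.1, n i : ℕ) : ℝ) < 1 := by linarith
          exact Nat.lt_one_iff.1 (by exact_mod_cast this)
        rw [h3] at h2
        refine ⟨funext fun i => ?_, by simpa using h2⟩
        by_cases hi : i ∈ p.1
        · exact Finset.sum_eq_zero_iff.1 h3 i hi
        · exact h1 i hi
      · rintro ⟨rfl, h⟩
        simpa using h
    rw [key]
    split_ifs with h1 <;> simp [h1]

/-- Height 1 arises from a box point of height 1, or from one of height 0 plus a single `b_i`, for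
which there are `d` choices. -/
theorem ncard_psi_eq_one (F : StackyFan L r) (hconv : Convex ℝ F.support) {x : V}
    (hx : x ∈ F.support) (hgen : F.IsGeneric x) :
    {v | v ∈ L ∧ v ∈ F.support ∧ F.psi v = 1}.Finite ∧
    {v | v ∈ L ∧ v ∈ F.support ∧ F.psi v = 1}.ncard =
      F.boxVector x 1 + Module.finrank ℝ V * F.boxVector x 0 := by
  classical
  have h := F.ncard_lattice_eq_sum hconv hx hgen (F.finite_boxPoints x) (fun y => y = 1)
    (fun p => if F.psi p.2 = 1 then {0} else if F.psi p.2 = 0 then Finset.piAntidiag p.1 1 else ∅) ?_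
  · refine ⟨h.1, h.2.trans ?_⟩
    rw [boxVector_apply, boxVector_apply, Finset.mul_sum, ← Finset.sum_add_distrib]
    refine Finset.sum_congr rfl fun p hp => ?_
    have hd := ((Set.Finite.mem_toFinset _).1 hp).1.2
    split_ifs <;> simp_all [Finset.card_piAntidiag_one]
  · intro p hp n
    obtain ⟨-, h0, -⟩ := F.psi_boxPoint hp
    have key : (∀ i ∉ p.1, n i = 0) ∧ F.psi p.2 + (∑ i ∈ p.1, n i : ℕ) = 1 ↔
        (n = 0 ∧ F.psi p.2 = 1) ∨ (n ∈ Finset.piAntidiag p.1 1 ∧ F.psi p.2 = 0) := by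
      rw [Finset.mem_piAntidiag]
      constructor
      · rintro ⟨h1, h2⟩
        have h3 : ∑ i ∈ p.1, n i ≤ 1 := by
          have : ((∑ i ∈ p.1, n i : ℕ) : ℝ) ≤ 1 := by linarith
          exact_mod_cast this
        rcases Nat.le_one_iff_eq_zero_or_eq_one.1 h3 with h3 | h3
        · rw [h3] at h2
          refine Or.inl ⟨funext fun i => ?_, by simpa using h2⟩
          by_cases hi : i ∈ p.1
          · exact Finset.sum_eq_zero_iff.1 h3 i hi
          · exact h1 i hi
        · rw [h3] at h2
          exact Or.inr ⟨⟨h3, fun i hi => by_contra fun h => hi (h1 i h)⟩, by simpa using h2⟩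
      · rintro (⟨rfl, h⟩ | ⟨⟨h1, h2⟩, h⟩)
        · simpa using h
        · refine ⟨fun i hi => by_contra fun h' => hi (h2 i h'), ?_⟩
          rw [h, show ∑ i ∈ p.1, n i = 1 from h1]
          simp
    rw [key]
    split_ifs with h1 h2 <;> simp [*]

theorem boxVector_zero (F : StackyFan L r) (hconv : Convex ℝ F.support) {x : V}
    (hx : x ∈ F.support) (hgen : F.IsGeneric x) : F.boxVector x 0 = 1 := by
  rw [← (F.ncard_psi_eq hconv hx hgen zero_lt_one).2, Set.ncard_eq_one]
  refine ⟨0, Set.eq_singleton_iff_unique_mem.2 ⟨⟨L.zero_mem, F.zero_mem_support, ?_⟩, ?_⟩⟩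
  · simp [F.psi_zero]
  · rintro v ⟨-, h1, h2⟩
    exact F.psi_eq_zero h1 (by simpa using h2)

open Classical in
theorem deltaPart_eq (F : StackyFan L r) (hconv : Convex ℝ F.support) {x : V}
    (hx : x ∈ F.support) (hgen : F.IsGeneric x) (k : ℚ) : F.deltaPart k =
    ∑ p ∈ F.boxFinset x, if F.weight p.2 = k then PowerSeries.X ^ ⌈F.psi p.2⌉₊ else 0 := by
  have h1 : PowerSeries.mk (fun m => (F.weightCount k m : ℤ)) =
      ∑ p ∈ F.boxFinset x, if F.weight p.2 = k then PowerSeries.X ^ ⌈F.psi p.2⌉₊ *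
        PowerSeries.mk (fun n => ((Module.finrank ℝ V + n).choose (Module.finrank ℝ V) : ℤ))
        else 0 := by
    ext m
    have h2 := F.ncard_psi_le hconv hx hgen m (fun y : ℝ => y - ⌈y⌉ = (k : ℝ)) fun y n => by
      rw [Int.ceil_add_natCast]
      push_cast
      rw [add_sub_add_right_eq_sub]
    have h3 : F.weightCount k m =
        {v | v ∈ L ∧ v ∈ F.support ∧ (F.psi v ≤ m ∧ F.psi v - ⌈F.psi v⌉ = k)}.ncard := by
      rw [weightCount]
      congr 1
      ext v
      simp only [Set.mem_ofPred_eq, mem_smul_Q_iff, and_assoc, weight]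
    rw [PowerSeries.coeff_mk, h3, h2, map_sum, Nat.cast_sum]
    refine Finset.sum_congr rfl fun p _ => ?_
    rw [weight]
    split_ifs with h4 h5
    · rw [PowerSeries.coeff_X_pow_mul', if_pos h5, PowerSeries.coeff_mk]
    · rw [PowerSeries.coeff_X_pow_mul', if_neg h5, Nat.cast_zero]
    · simp
  rw [deltaPart, h1, Finset.mul_sum]
  refine Finset.sum_congr rfl fun p _ => ?_
  split_ifs
  · rw [mul_left_comm, mul_comm (_ ^ (_ + 1)), PowerSeries.mk_add_choose_mul_one_sub_pow_eq_one,
      mul_one]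
  · rw [mul_zero]

theorem weightedDelta_eq (F : StackyFan L r) (hconv : Convex ℝ F.support) {x : V}
    (hx : x ∈ F.support) (hgen : F.IsGeneric x) : F.weightedDelta =
    ∑ p ∈ F.boxFinset x, HahnSeries.single (F.ratPsi p.2) 1 := by
  classical
  have h1 : ∀ k : ℚ, HahnSeries.ofPowerSeries ℚ ℤ (F.deltaPart k) * HahnSeries.single k 1 =
      ∑ p ∈ F.boxFinset x, if k = F.ratPsi p.2 - ⌈F.psi p.2⌉₊ then
        HahnSeries.single (F.ratPsi p.2) 1 else 0 := by
    intro k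
    rw [F.deltaPart_eq hconv hx hgen, map_sum, Finset.sum_mul]
    refine Finset.sum_congr rfl fun p hp => ?_
    obtain ⟨h2, h3, -⟩ := F.psi_boxPoint (F.mem_boxFinset.1 hp)
    have h4 : F.weight p.2 = k ↔ k = F.ratPsi p.2 - ⌈F.psi p.2⌉₊ := by
      rw [weight, ← natCast_ceil_eq_intCast_ceil h3, ← @Rat.cast_inj ℝ, eq_comm]
      push_cast
      rw [← h2]
    simp only [h4]
    split_ifs with h5
    -- The exponents recombine: `⌈ψ⌉ + w₀ = ψ`.
    · rw [HahnSeries.ofPowerSeries_X_pow, HahnSeries.single_mul_single, h5, mul_one,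
        add_sub_cancel]
    · rw [map_zero, zero_mul]
  rw [weightedDelta, finsum_congr h1, finsum_sum_comm]
  · refine Finset.sum_congr rfl fun p _ => ?_
    rw [finsum_eq_single _ (F.ratPsi p.2 - ⌈F.psi p.2⌉₊) fun k hk => if_neg hk, if_pos rfl]
  · intro p _
    refine (Set.finite_singleton (F.ratPsi p.2 - ⌈F.psi p.2⌉₊)).subset fun k hk => ?_
    exact by_contra fun h => hk (if_neg h)

theorem coeff_weightedDelta (F : StackyFan L r) (hconv : Convex ℝ F.support) {x : V}
    (hx : x ∈ F.support) (hgen : F.IsGeneric x) (q : ℚ) :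
    F.weightedDelta.coeff q = (F.boxVector x q : ℤ) := by
  rw [F.weightedDelta_eq hconv hx hgen, HahnSeries.coeff_sum, boxVector, Finsupp.finsetSum_apply,
    Nat.cast_sum]
  refine Finset.sum_congr rfl fun p _ => ?_
  rw [Finsupp.single_apply, HahnSeries.coeff_single]
  simp [eq_comm]

theorem boxVector_neg (F : StackyFan L r) {x : V} (hgen : F.IsGeneric x) (q : ℚ) :
    F.boxVector (-x) q = F.boxVector x ((Module.finrank ℝ V : ℚ) - q) := by
  classical
  have hs : ∀ {σ : Finset (Fin r)}, ∀ i ∉ σ, (if i ∈ σ then (1 : ℝ) else 0) = 0 :=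
    fun i hi => if_neg hi
  let c : Finset (Fin r) → Fin r → ℝ := fun σ i => if i ∈ σ then 1 else 0
  let Φ : Finset (Fin r) × V → Finset (Fin r) × V := fun p => (p.1, F.comb (c p.1) - p.2)
  have hcoord : ∀ p : Finset (Fin r) × V, F.IsFull p.1 → ∀ i ∈ p.1,
      F.coord p.1 (Φ p).2 i = 1 - F.coord p.1 p.2 i := by
    intro p hp i hi
    simp only [Φ]
    rw [map_sub, F.coord_comb hp hs]
    simp [hi]
  have hmaps : ∀ y : V, F.IsGeneric y → ∀ p ∈ F.boxPoints y, Φ p ∈ F.boxPoints (-y) := by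
    intro y hy p hp
    refine ⟨hp.1, L.sub_mem ?_ hp.2.1, fun i hi => ?_⟩
    · have := F.comb_natCast_mem (fun i => if i ∈ p.1 then 1 else 0)
      simpa [c] using this
    · change i ∈ p.1 at hi
      change 0 ≤ F.coord p.1 (Φ p).2 i ∧ F.coord p.1 (Φ p).2 i ≤ 1 ∧
        (F.coord p.1 (-y) i < 0 → 0 < F.coord p.1 (Φ p).2 i) ∧
        (¬ F.coord p.1 (-y) i < 0 → F.coord p.1 (Φ p).2 i < 1)
      rw [hcoord p hp.1 i hi, map_neg, Pi.neg_apply]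
      obtain ⟨h1, h2, h3, h4⟩ := hp.2.2 i hi
      -- As no coordinate of `y` is zero, negation flips every sign and so swaps the open and closed
      -- ends, exactly as `t ↦ 1 - t` does.
      have h5 := hy.coord_ne_zero hp.1 hi
      refine ⟨by linarith, by linarith, fun h => ?_, fun h => ?_⟩
      · linarith [h4 (by linarith)]
      · linarith [h3 (lt_of_le_of_ne (by linarith) h5)]
  have hinv : ∀ p, Φ (Φ p) = p := fun p => by simp [Φ]
  have hpsi : ∀ p ∈ F.boxPoints x, F.psi (Φ p).2 = Module.finrank ℝ V - F.psi p.2 := by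
    intro p hp
    rw [F.psi_eq_sum_coord hp.1 fun i hi => ((hmaps x hgen p hp).2.2 i hi).1,
      F.psi_eq_sum_coord hp.1 fun i hi => (hp.2.2 i hi).1, ← hp.1.2,
      ← Finset.sum_subset (Finset.subset_univ p.1) fun i _ hi => F.coord_eq_zero p.2 hi,
      ← Finset.sum_subset (Finset.subset_univ p.1) fun i _ hi => F.coord_eq_zero _ hi,
      Finset.sum_congr rfl (hcoord p hp.1)]
    simp
  rw [boxVector_apply, boxVector_apply]
  symm
  refine Finset.sum_nbij' Φ Φ ?_ ?_ (fun p _ => hinv p) (fun p _ => hinv p) ?_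
  · intro p hp
    exact F.mem_boxFinset.2 (hmaps x hgen p (F.mem_boxFinset.1 hp))
  · intro p hp
    have := hmaps (-x) hgen.neg p (F.mem_boxFinset.1 hp)
    rw [neg_neg] at this
    exact F.mem_boxFinset.2 this
  · intro p hp
    rw [hpsi p (F.mem_boxFinset.1 hp)]
    congr 1
    push_cast
    rw [eq_iff_iff]
    constructor <;> intro h <;> linarith

/-- Divided by `m^d`, the count in `mQ` tends to the volume, while each box point contributes a
binomial tending to `1/d!`. -/
theorem card_boxFinset_eq (F : StackyFan L r) (hconv : Convex ℝ F.support) {x : V}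
    (hx : x ∈ F.support) (hgen :
    F.IsGeneric x) [MeasurableSpace V] [BorelSpace V] [IsZLattice ℝ L] :
    ((F.boxFinset x).card : ℝ) = (Module.finrank ℝ V).factorial * latticeVolume L F.Q := by
  set d := Module.finrank ℝ V with hd
  have h1 := F.tendsto_ncard_div_pow
  have h2 : ∀ m : ℕ, ({v | v ∈ L ∧ v ∈ F.support ∧ F.psi v ≤ m}.ncard : ℝ) =
      ∑ p ∈ F.boxFinset x,
        ((if ⌈F.psi p.2⌉₊ ≤ m then (d + (m - ⌈F.psi p.2⌉₊)).choose d else 0 : ℕ) : ℝ) := by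
    intro m
    have := F.ncard_psi_le hconv hx hgen m (fun _ => True) fun _ _ => Iff.rfl
    simp only [and_true, if_true] at this
    rw [this, Nat.cast_sum]
  have h3 : Tendsto (fun m : ℕ => ({v | v ∈ L ∧ v ∈ F.support ∧ F.psi v ≤ m}.ncard : ℝ) /
      (m : ℝ) ^ d) atTop (𝓝 (∑ p ∈ F.boxFinset x, 1 / (d.factorial : ℝ))) := by
    simp only [h2, Finset.sum_div]
    refine tendsto_finsetSum _ fun p _ => ?_
    refine (tendsto_choose_add_sub_div_pow d ⌈F.psi p.2⌉₊).congr' ?_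
    filter_upwards [eventually_ge_atTop ⌈F.psi p.2⌉₊] with m hm
    rw [if_pos hm]
  have h4 := tendsto_nhds_unique h1 h3
  rw [h4, Finset.sum_const, nsmul_eq_mul]
  field_simp

end StackyFan

/-! ### The main theorem. -/

theorem lemma3p12 {V : Type*} [NormedAddCommGroup V] [NormedSpace ℝ V] [FiniteDimensional ℝ V]
    [MeasurableSpace V] [BorelSpace V]
    (L : Submodule ℤ V) [DiscreteTopology L] [IsZLattice ℝ L]
    (d : ℕ) (hd : Module.finrank ℝ V = d)
    (r : ℕ) (F : StackyFan L r)
    (hdim : ∃ σ ∈ F.cones, σ.card = d)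
    (hconv : Convex ℝ F.support) :
    ∃ p : ℚ →₀ ℕ,
      (∀ q : ℚ, F.weightedDelta.coeff q = (p q : ℤ)) ∧
      (∀ q ∈ p.support, 0 ≤ q ∧ q ≤ (d : ℚ)) ∧
      (F.IsComplete → ∀ q : ℚ, p q = p ((d : ℚ) - q)) ∧
      ratPolyEval p 1 = (d.factorial : ℝ) * latticeVolume L F.Q ∧
      p 0 = 1 ∧
      (∀ l : ℚ, 0 < l → l < 1 →
        {x : V | x ∈ F.Q ∧ x ∈ L ∧ F.psi x = (l : ℝ)}.Finite ∧
        p l = {x : V | x ∈ F.Q ∧ x ∈ L ∧ F.psi x = (l : ℝ)}.ncard) ∧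
      (F.outerBoundary ∩ (L : Set V)).Finite ∧
      (p 1 : ℤ) = ((F.outerBoundary ∩ (L : Set V)).ncard : ℤ) - (d : ℤ) := by
  subst hd
  obtain ⟨σ, hσ⟩ := hdim
  obtain ⟨x, hx, hgen⟩ := F.exists_isGeneric ⟨σ, hσ⟩
  have hout : F.outerBoundary ∩ (L : Set V) = {v | v ∈ L ∧ v ∈ F.support ∧ F.psi v = 1} := by
    rw [F.outerBoundary_eq hconv hx hgen]
    ext v
    exact and_comm
  obtain ⟨hone_fin, hone⟩ := F.ncard_psi_eq_one hconv hx hgen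
  refine ⟨F.boxVector x, F.coeff_weightedDelta hconv hx hgen, fun q => F.boxVector_bounds x,
    fun hcomplete q => ?_, ?_, F.boxVector_zero hconv hx hgen, fun l _ hl => ?_, ?_, ?_⟩
  · have hx' : -x ∈ F.support := by
      rw [show F.support = Set.univ from hcomplete]
      trivial
    rw [← F.boxVector_neg hgen]
    -- Both `x` and `-x` compute the same coefficients of `δ⁰`.
    have h := F.coeff_weightedDelta hconv hx' hgen.neg q
    rw [F.coeff_weightedDelta hconv hx hgen] at h
    exact_mod_cast h
  · rw [F.ratPolyEval_boxVector, F.card_boxFinset_eq hconv hx hgen]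
  · have hset : {x : V | x ∈ F.Q ∧ x ∈ L ∧ F.psi x = (l : ℝ)} =
        {v | v ∈ L ∧ v ∈ F.support ∧ F.psi v = l} := by
      ext v
      constructor
      · rintro ⟨h1, h2, h3⟩
        exact ⟨h2, h1.1, h3⟩
      · rintro ⟨h1, h2, h3⟩
        exact ⟨⟨h2, h3.le.trans (by exact_mod_cast hl.le)⟩, h1, h3⟩
    obtain ⟨h1, h2⟩ := F.ncard_psi_eq hconv hx hgen hl
    rw [hset]
    exact ⟨h1, h2.symm⟩
  · rw [hout]
    exact hone_fin
  · rw [hout, hone, F.boxVector_zero hconv hx hgen]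
    push_cast
    ring

end
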